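/- Let $N \ge 3$ be an integer, let $p = \frac{N+2}{N-2}$ and $\tilde B(x) = (1+|x|^2)^{-\frac{N-2}{2}}$ for $x \in \mathbb R^N$, and let $$w_0(x) = \frac{1-|x|^2}{(1+|x|^2)^{N/2}}, \qquad w_i(x) = \frac{x_i}{(1+|x|^2)^{N/2}} \quad (i = 1,\dots,N).$$ Let $v \in C^2(\mathbb R^N)$ be a real-valued solution of $$-\Delta v = N(N+2)\,\tilde B^{p-1} v \qquad \text{on } \mathbb R^N,$$ and suppose that for some real $\tau \ge -N+2$ there is a constant $C$ with $|v(x)| \le C|x|^\tau$ for all $|x| \ge 1$. Then there are real numbers $c_0,\dots,c_N$ and, for every integer $k \ge 2$, a smooth function $v_k^-\colon (0,\infty) \to \mathbb R$ and a (possibly zero) spherical harmonic $Y_k$ of degree $k$ on $\mathbb S^{N-1}$ (the restriction to $\mathbb S^{N-1}$ of a harmonic homogeneous polynomial of degree $k$) such that, for all $x \ne 0$, with $r = |x|$ and $\omega = x/|x|$, $$v(x) = \sum_{i=0}^{N} c_i w_i(x) + \sum_{2 \le k \le \tau} v_k^-(r)\, Y_k(\omega),$$ where the second sum runs over the integers $k$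 with $2 \le k \le \lfloor\tau\rfloor$ and is empty if $\tau < 2$. Moreover, for every $k \ge 2$, either $v_k^- \equiv 0$ on $(0,\infty)$, or $v_k^-(r) \sim r^k$ both as $r \to 0$ and as $r \to \infty$; here $f \sim g$ means that, near the limit point, $f$ and $g$ are nonnegative and there is a constant $C > 0$ with $f \le C g$ and $g \le C f$. -/

import Mathlib

open scoped ContDiff Laplacian Topology

noncomputable section

/-- The normalized bubble `(1 + |x|^2)^(-(N-2)/2)` on `ℝ^N`. -/
def bubble (N : ℕ) (x : EuclideanSpace ℝ (Fin N)) : ℝ :=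
  (1 + ‖x‖ ^ 2) ^ (-(((N : ℝ) - 2) / 2))

/-- The critical exponent `p = (N+2)/(N-2)`. -/
def critExp (N : ℕ) : ℝ := ((N : ℝ) + 2) / ((N : ℝ) - 2)

/-- `v` is a (classical, `C^2`) solution on `ℝ^N` of
`-Δ v = N (N+2) B^(p-1) v`, with `B` the normalized bubble. -/
def IsLinearizedSolution (N : ℕ) (v : EuclideanSpace ℝ (Fin N) → ℝ) : Prop :=
  ContDiff ℝ 2 v ∧
    ∀ x, -(Δ v x) = (N : ℝ) * ((N : ℝ) + 2) * bubble N x ^ (critExp N - 1) * v x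

/-- The kernel function `w_0`, coming from dilations of the bubble. -/
def kernelZero (N : ℕ) (x : EuclideanSpace ℝ (Fin N)) : ℝ :=
  (1 - ‖x‖ ^ 2) / (1 + ‖x‖ ^ 2) ^ ((N : ℝ) / 2)

/-- The kernel functions `w_1, …, w_N`, coming from translations of the bubble. -/
def kernelTrans (N : ℕ) (i : Fin N) (x : EuclideanSpace ℝ (Fin N)) : ℝ :=
  x i / (1 + ‖x‖ ^ 2) ^ ((N : ℝ) / 2)

/-- A (real) spherical harmonic of degree `k` on the unit sphere of `ℝ^N`: the restriction of a
harmonic homogeneous polynomial of degree `k` (the zero function is included). -/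
def IsSphericalHarmonic (N k : ℕ)
    (Y : Metric.sphere (0 : EuclideanSpace ℝ (Fin N)) 1 → ℝ) : Prop :=
  ∃ P : MvPolynomial (Fin N) ℝ, P.IsHomogeneous k ∧
    ∑ i, MvPolynomial.pderiv i (MvPolynomial.pderiv i P) = 0 ∧
    ∀ ξ, Y ξ = MvPolynomial.eval (fun i => (ξ : EuclideanSpace ℝ (Fin N)) i) P

/-- `f ∼ g` along the filter `l`: eventually both functions are nonnegative, and each is bounded
by a constant multiple of the other. -/
def ComparableAlong (l : Filter ℝ) (f g : ℝ → ℝ) : Prop :=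
  ∃ C : ℝ, 0 < C ∧ ∀ᶠ r in l, 0 ≤ f r ∧ 0 ≤ g r ∧ f r ≤ C * g r ∧ g r ≤ C * f r

end

/-! ### Fischer decomposition of homogeneous polynomials. -/

noncomputable section

/-! Separation of variables, carried out by Green's identity instead of an ODE for the coefficients.
For `P` harmonic and homogeneous of degree `k`, the function `F(|x|²) P(x)` solves the equation
exactly when `F` satisfies a second-order ODE in `s = r²`. Writing `F = (1+s)^(-N/2) J` turns this
into a hypergeometric equation for `J`, with regular solution `1 - s` for `k = 0`, `1` for `k = 1`,
and Euler's integral for `k ≥ 2`. The first two give the kernel functions `w_0` and `w_i`; the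
integral is comparable to `(1+s)^(N/2)`, so the corresponding mode `f_k(r) = r^k F(r²)` is
comparable to `r^k` on the whole half-line (`radialProfile_bounds`).

For a solution `v`, let `A(r)` be the integral over the unit sphere of `v(rξ) Q(ξ)`, with `Q`
harmonic of degree `k`. Green's identity for `v` and `F(|x|²) Q(x)` gives `A f_k' = f_k A'`
(`sphereCoeff_mul_deriv_radialPart`). Both functions are `C²` across the origin, so the Wronskian is
zero and not merely a multiple of `r^(1-N)`; this excludes the singular radial solution. Hence `A`
is a constant multiple of `f_k`, and the growth bound makes that constant vanish when `k ≥ 2` and `k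
> τ`.

On every sphere, `v` and the finite sum of surviving modes thus have the same pairings with all
spherical harmonics. They coincide because harmonics are complete
(`eq_zero_of_orthogonal_harmonics`), which follows from Stone–Weierstrass and the Fischer
decomposition. No infinite expansion of `v` is ever needed. -/

open MvPolynomial in
/-- The Laplacian on polynomials in `N` variables. -/
def polyLaplacian (N : ℕ) : MvPolynomial (Fin N) ℝ →ₗ[ℝ] MvPolynomial (Fin N) ℝ :=
  ∑ i, (pderiv i : Derivation ℝ _ _).toLinearMap ∘ₗ (pderiv i : Derivation ℝ _ _).toLinearMap

/-- Harmonic homogeneous polynomials of degree `k` in `N` variables. -/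
def harmonicSubmodule (N k : ℕ) : Submodule ℝ (MvPolynomial (Fin N) ℝ) :=
  MvPolynomial.homogeneousSubmodule (Fin N) ℝ k ⊓ LinearMap.ker (polyLaplacian N)

/-- The polynomial `∑ i, X i ^ 2`. -/
def normSqPoly (N : ℕ) : MvPolynomial (Fin N) ℝ := ∑ i, MvPolynomial.X i ^ 2

/-- The span of the products `|x|^(2j) h` of degree `d`, with `h` harmonic and homogeneous. -/
def fischerSpan (N d : ℕ) : Submodule ℝ (MvPolynomial (Fin N) ℝ) :=
  Submodule.span ℝ {q | ∃ j k h, 2 * j + k = d ∧ h ∈ harmonicSubmodule N k ∧ q = normSqPoly N ^ j * h}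

end

namespace MvPolynomial

variable {N : ℕ}

theorem polyLaplacian_apply (p : MvPolynomial (Fin N) ℝ) :
    polyLaplacian N p = ∑ i, pderiv i (pderiv i p) := by
  simp [polyLaplacian]

theorem mem_harmonicSubmodule {k : ℕ} {p : MvPolynomial (Fin N) ℝ} :
    p ∈ harmonicSubmodule N k ↔ p.IsHomogeneous k ∧ ∑ i, pderiv i (pderiv i p) = 0 := by
  simp [harmonicSubmodule, polyLaplacian_apply]

theorem pderiv_normSqPoly (i : Fin N) : pderiv i (normSqPoly N) = 2 * X i := by
  classical
  simp [normSqPoly, pderiv_X, Pi.single_apply, Derivation.leibniz_pow]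

theorem isHomogeneous_normSqPoly : (normSqPoly N).IsHomogeneous 2 :=
  IsHomogeneous.sum _ _ _ fun i _ => by simpa using (isHomogeneous_X ℝ i).pow 2

theorem isHomogeneous_polyLaplacian {p : MvPolynomial (Fin N) ℝ} {d : ℕ} (hp : p.IsHomogeneous d) :
    (polyLaplacian N p).IsHomogeneous (d - 2) := by
  rw [polyLaplacian_apply]
  exact IsHomogeneous.sum _ _ _ fun i _ => hp.pderiv.pderiv

theorem polyLaplacian_eq_zero_of_degree_lt_two {p : MvPolynomial (Fin N) ℝ} {d : ℕ}
    (hp : p.IsHomogeneous d) (hd : d < 2) : polyLaplacian N p = 0 := by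
  rw [polyLaplacian_apply]
  refine Finset.sum_eq_zero fun i _ => ?_
  have h0 : (pderiv i p).IsHomogeneous 0 := by
    have := hp.pderiv (i := i)
    rwa [show d - 1 = 0 by omega] at this
  rw [totalDegree_eq_zero_iff_eq_C.mp ((totalDegree_zero_iff_isHomogeneous _).mpr h0), pderiv_C]

theorem polyLaplacian_normSqPoly_mul {q : MvPolynomial (Fin N) ℝ} {d : ℕ}
    (hq : q.IsHomogeneous d) :
    polyLaplacian N (normSqPoly N * q) =
      (2 * N + 4 * d : ℝ) • q + normSqPoly N * polyLaplacian N q := by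
  have h : ∀ i : Fin N, pderiv i (pderiv i (normSqPoly N * q)) =
      2 * q + 4 * (X i * pderiv i q) + normSqPoly N * pderiv i (pderiv i q) := by
    intro i
    have h2 : pderiv i (2 : MvPolynomial (Fin N) ℝ) = 0 := by
      rw [← map_ofNat C 2, pderiv_C]
    simp only [Derivation.leibniz, pderiv_normSqPoly, map_add, smul_eq_mul, pderiv_X_self, h2]
    ring
  simp only [polyLaplacian_apply, h, Finset.sum_add_distrib, ← Finset.mul_sum,
    hq.sum_X_mul_pderiv, Finset.sum_const, Finset.card_univ, Fintype.card_fin]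
  simp only [nsmul_eq_mul, smul_eq_C_mul]
  simp only [map_add, map_mul, map_natCast, map_ofNat]
  ring

theorem polyLaplacian_normSqPoly_pow_mul {h : MvPolynomial (Fin N) ℝ} {k : ℕ}
    (hh : h ∈ harmonicSubmodule N k) (j : ℕ) :
    polyLaplacian N (normSqPoly N ^ (j + 1) * h) =
      (2 * (j + 1) * (2 * j + N + 2 * k) : ℝ) • (normSqPoly N ^ j * h) := by
  have hz : polyLaplacian N h = 0 := hh.2
  induction j with
  | zero =>
    rw [zero_add, pow_one, polyLaplacian_normSqPoly_mul hh.1, hz]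
    simp only [mul_zero, add_zero, pow_zero, one_mul]
    congr 1
    push_cast
    ring
  | succ j ih =>
    have hd : (normSqPoly N ^ (j + 1) * h).IsHomogeneous (2 * (j + 1) + k) :=
      (isHomogeneous_normSqPoly.pow _).mul hh.1
    rw [pow_succ', mul_assoc, polyLaplacian_normSqPoly_mul hd, ih, mul_smul_comm, ← mul_assoc,
      ← pow_succ', ← add_smul]
    congr 1
    push_cast
    ring

/-- Induction on the degree: the Laplacian maps the degree `d` span onto the degree `d - 2` span,
because it sends `|x|^(2j+2) h` to a nonzero multiple of `|x|^(2j) h`. Subtracting from `p` an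
element of the span with the same Laplacian leaves a harmonic polynomial. -/
theorem mem_fischerSpan_of_isHomogeneous (hN : 0 < N) (d : ℕ) {p : MvPolynomial (Fin N) ℝ}
    (hp : p.IsHomogeneous d) : p ∈ fischerSpan N d := by
  have key : ∀ {d : ℕ} {p : MvPolynomial (Fin N) ℝ}, p ∈ harmonicSubmodule N d →
      p ∈ fischerSpan N d := fun {d p} h => Submodule.subset_span ⟨0, d, p, by simp, h, by simp⟩
  induction d using Nat.strong_induction_on generalizing p with
  | _ d ih =>
    rcases lt_or_ge d 2 with hd | hd
    · exact key ⟨hp, polyLaplacian_eq_zero_of_degree_lt_two hp hd⟩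
    · have hsurj : ∀ q ∈ fischerSpan N (d - 2), ∃ Q ∈ fischerSpan N d,
          Q.IsHomogeneous d ∧ polyLaplacian N Q = q := by
        intro q hq
        induction hq using Submodule.span_induction with
        | mem q hq =>
          obtain ⟨j, k, h, hjk, hh, rfl⟩ := hq
          have hc : (2 * (j + 1) * (2 * j + N + 2 * k) : ℝ) ≠ 0 := by positivity
          have hdeg : 2 * (j + 1) + k = d := by omega
          refine ⟨(2 * (j + 1) * (2 * j + N + 2 * k) : ℝ)⁻¹ • (normSqPoly N ^ (j + 1) * h),
            Submodule.smul_mem _ _ (Submodule.subset_span ⟨j + 1, k, h, hdeg, hh, rfl⟩),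
            (homogeneousSubmodule (Fin N) ℝ d).smul_mem _
              (hdeg ▸ (isHomogeneous_normSqPoly.pow _).mul hh.1), ?_⟩
          rw [map_smul, polyLaplacian_normSqPoly_pow_mul hh, inv_smul_smul₀ hc]
        | zero => exact ⟨0, zero_mem _, isHomogeneous_zero _ _ _, map_zero _⟩
        | add x y _ _ hx hy =>
          obtain ⟨Q, h1, h2, h3⟩ := hx
          obtain ⟨R, h4, h5, h6⟩ := hy
          exact ⟨Q + R, add_mem h1 h4, h2.add h5, by rw [map_add, h3, h6]⟩
        | smul a x _ hx =>
          obtain ⟨Q, h1, h2, h3⟩ := hx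
          exact ⟨a • Q, Submodule.smul_mem _ _ h1, (homogeneousSubmodule (Fin N) ℝ d).smul_mem _ h2,
            by rw [map_smul, h3]⟩
      obtain ⟨Q, hQ, hQd, hQp⟩ := hsurj _ (ih (d - 2) (by omega) (isHomogeneous_polyLaplacian hp))
      have : p - Q ∈ harmonicSubmodule N d :=
        ⟨(homogeneousSubmodule (Fin N) ℝ d).sub_mem hp hQd, by simp [hQp]⟩
      simpa using add_mem (key this) hQ

end MvPolynomial

/-! ### The radial ODE and its regular solutions. -/

section Radial

open Set

/-- The parametric integral `∫_0^1 φ(t) (1 + t s)^m dt`. -/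
noncomputable def eulerIntegral (φ : ℝ → ℝ) (m s : ℝ) : ℝ :=
  ∫ t in (0 : ℝ)..1, φ t * (1 + t * s) ^ m

theorem one_add_mul_pos {t s : ℝ} (ht : t ∈ Icc (0 : ℝ) 1) (hs : -1 < s) : 0 < 1 + t * s := by
  rcases ht.2.lt_or_eq with h | rfl
  · nlinarith [mul_nonneg ht.1 (by linarith : (0 : ℝ) ≤ 1 + s)]
  · linarith

theorem continuousOn_eulerIntegrand {φ : ℝ → ℝ} (hφ : Continuous φ) (m : ℝ) :
    ContinuousOn (fun z : ℝ × ℝ => φ z.1 * (1 + z.1 * z.2) ^ m) (Icc 0 1 ×ˢ Ioi (-1)) := by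
  refine ContinuousOn.mul (by fun_prop) (ContinuousOn.rpow_const (by fun_prop) fun z hz => ?_)
  exact Or.inl (one_add_mul_pos hz.1 hz.2).ne'

theorem continuousOn_eulerIntegrand_left {φ : ℝ → ℝ} (hφ : Continuous φ) (m : ℝ) {s : ℝ}
    (hs : -1 < s) : ContinuousOn (fun t : ℝ => φ t * (1 + t * s) ^ m) (Icc 0 1) :=
  (continuousOn_eulerIntegrand hφ m).comp (f := fun t : ℝ => (t, s)) (by fun_prop)
    fun _ ht => ⟨ht, hs⟩

theorem intervalIntegrable_eulerIntegrand {φ : ℝ → ℝ} (hφ : Continuous φ) (m : ℝ) {s : ℝ}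
    (hs : -1 < s) :
    IntervalIntegrable (fun t : ℝ => φ t * (1 + t * s) ^ m) MeasureTheory.volume 0 1 :=
  ContinuousOn.intervalIntegrable_of_Icc zero_le_one (continuousOn_eulerIntegrand_left hφ m hs)

theorem hasDerivAt_eulerIntegral {φ : ℝ → ℝ} (hφ : Continuous φ) (m : ℝ) {s : ℝ} (hs : -1 < s) :
    HasDerivAt (eulerIntegral φ m) (m * eulerIntegral (fun t => φ t * t) (m - 1) s) s := by
  -- Half the distance from `s` to the singular point `-1`, so the closed interval of radius `δ`
  -- stays in the domain.
  set δ : ℝ := (s + 1) / 2 with hδ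
  have hδ0 : 0 < δ := by rw [hδ]; linarith
  have hsub : Icc (s - δ) (s + δ) ⊆ Ioi (-1) := fun x hx => by
    have := hx.1
    simp only [mem_Ioi]
    linarith
  have hcont : Continuous fun t => φ t * t := by fun_prop
  obtain ⟨B, hB⟩ := (isCompact_Icc.prod (isCompact_Icc (a := s - δ) (b := s + δ))).exists_bound_of_continuousOn
    ((continuousOn_eulerIntegrand hcont (m - 1)).mono (Set.prod_mono subset_rfl hsub))
  have hmem : ∀ t ∈ Set.uIoc (0 : ℝ) 1, t ∈ Icc (0 : ℝ) 1 := fun t ht => by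
    rw [uIoc_of_le zero_le_one] at ht
    exact Ioc_subset_Icc_self ht
  have hball : ∀ x ∈ Metric.ball s δ, x ∈ Icc (s - δ) (s + δ) := fun x hx => by
    rw [Real.ball_eq_Ioo] at hx
    exact Ioo_subset_Icc_self hx
  have h := (intervalIntegral.hasDerivAt_integral_of_dominated_loc_of_deriv_le
    (F := fun x t => φ t * (1 + t * x) ^ m)
    (F' := fun x t => m * (φ t * t * (1 + t * x) ^ (m - 1))) (x₀ := s) (a := 0) (b := 1)
    (bound := fun _ => |m| * B) (μ := MeasureTheory.volume) (Metric.ball_mem_nhds s hδ0)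
    ?_ (intervalIntegrable_eulerIntegrand hφ m hs) ?_ ?_ (by simp) ?_).2
  · rw [intervalIntegral.integral_const_mul] at h
    exact h
  · filter_upwards [Metric.ball_mem_nhds s hδ0] with x hx
    exact (intervalIntegrable_eulerIntegrand hφ m (hsub (hball x hx))).aestronglyMeasurable_restrict_uIoc
  · exact ((intervalIntegrable_eulerIntegrand hcont (m - 1) hs).const_mul m).aestronglyMeasurable_restrict_uIoc
  · refine Filter.Eventually.of_forall fun t ht x hx => ?_
    rw [norm_mul, Real.norm_eq_abs]
    exact mul_le_mul_of_nonneg_left (hB (t, x) ⟨hmem t ht, hball x hx⟩) (abs_nonneg m)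
  · refine Filter.Eventually.of_forall fun t ht x hx => ?_
    have hpos := one_add_mul_pos (hmem t ht) (hsub (hball x hx))
    have h1 : HasDerivAt (fun x : ℝ => 1 + t * x) t x := by
      simpa using ((hasDerivAt_id x).const_mul t).const_add 1
    exact ((h1.rpow_const (p := m) (Or.inl hpos.ne')).const_mul (φ t)).congr_deriv (by ring)

theorem contDiffOn_eulerIntegral {φ : ℝ → ℝ} (hφ : Continuous φ) (m : ℝ) :
    ContDiffOn ℝ ∞ (eulerIntegral φ m) (Ioi (-1)) := by
  rw [contDiffOn_infty]
  intro n
  induction n generalizing φ m with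
  | zero =>
    exact contDiffOn_zero.mpr fun s hs => (hasDerivAt_eulerIntegral hφ m hs).continuousAt.continuousWithinAt
  | succ n ih =>
    push_cast
    rw [contDiffOn_succ_iff_deriv_of_isOpen isOpen_Ioi]
    refine ⟨fun s hs => (hasDerivAt_eulerIntegral hφ m hs).differentiableAt.differentiableWithinAt,
      by simp, ?_⟩
    have hc : Continuous fun t => φ t * t := by fun_prop
    exact ((ih hc (m - 1)).const_smul m).congr fun s hs => by
      rw [(hasDerivAt_eulerIntegral hφ m hs).deriv]; rfl

/-- The hypergeometric equation for `∫_0^1 t^k (1-t)^n (1+ts)^n dt`. -/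
theorem eulerIntegral_ode (k : ℕ) {n s : ℝ} (hn : 0 ≤ n) (hs : -1 < s) :
    let φ : ℝ → ℝ := fun t => t ^ k * (1 - t) ^ n
    s * (1 + s) * (n * ((n - 1) * eulerIntegral (fun t => φ t * t * t) (n - 1 - 1) s)) +
      ((k + 2) + n + ((k + 2) - n) * s) * (n * eulerIntegral (fun t => φ t * t) (n - 1) s) -
      n * (k + 1) * eulerIntegral φ n s = 0 := by
  intro φ
  have hφ : Continuous φ := by
    have : Continuous fun t : ℝ => (1 - t) ^ n := Continuous.rpow_const (by fun_prop) fun _ => Or.inr hn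
    fun_prop
  have hφ1 : Continuous fun t => φ t * t := by fun_prop
  have hφ2 : Continuous fun t => φ t * t * t := by fun_prop
  have i0 := intervalIntegrable_eulerIntegrand hφ n hs
  have i1 := intervalIntegrable_eulerIntegrand hφ1 (n - 1) hs
  have i2 := intervalIntegrable_eulerIntegrand hφ2 (n - 1 - 1) hs
  -- The differential operator applied to the integrand is an exact `t`-derivative. Its primitive
  -- vanishes at `0` through `t^(k+1)` and at `1` through `(1-t)^(n+1)`, so the integral is
  -- annihilated.
  have hderiv : ∀ t ∈ Set.uIcc (0 : ℝ) 1, HasDerivAt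
      (fun t => -n * (t ^ (k + 1) * (1 - t) ^ (n + 1) * (1 + t * s) ^ (n - 1)))
      (s * (1 + s) * (n * (n - 1)) * (φ t * t * t * (1 + t * s) ^ (n - 1 - 1)) +
        ((k + 2) + n + ((k + 2) - n) * s) * n * (φ t * t * (1 + t * s) ^ (n - 1)) -
        n * (k + 1) * (φ t * (1 + t * s) ^ n)) t := by
    intro t ht
    rw [uIcc_of_le zero_le_one] at ht
    have hpos := one_add_mul_pos ht hs
    have h1 : HasDerivAt (fun t : ℝ => 1 + t * s) s t := by
      simpa using ((hasDerivAt_id t).mul_const s).const_add 1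
    have h2 : HasDerivAt (fun t : ℝ => 1 - t) (-1) t := by
      simpa using (hasDerivAt_id t).const_sub 1
    have h3 := (((hasDerivAt_pow (k + 1) t).mul
      (h2.rpow_const (p := n + 1) (Or.inr (by linarith)))).mul
      (h1.rpow_const (p := n - 1) (Or.inl hpos.ne'))).const_mul (-n)
    refine HasDerivAt.congr_deriv h3 ?_
    have e1 : (1 + t * s) ^ n = (1 + t * s) ^ (n - 1 - 1) * (1 + t * s) * (1 + t * s) := by
      rw [← Real.rpow_add_one hpos.ne', ← Real.rpow_add_one hpos.ne']; congr 1; ring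
    have e2 : (1 + t * s) ^ (n - 1) = (1 + t * s) ^ (n - 1 - 1) * (1 + t * s) := by
      rw [← Real.rpow_add_one hpos.ne']; congr 1; ring
    have e3 : (1 - t) ^ (n + 1) = (1 - t) ^ n * (1 - t) :=
      Real.rpow_add_one' (by linarith [ht.2]) (by linarith)
    simp only [φ, e1, e2, e3, add_sub_cancel_right, Nat.add_sub_cancel, Pi.mul_apply]
    push_cast
    ring
  have hint := ((i2.const_mul (s * (1 + s) * (n * (n - 1)))).add
      (i1.const_mul (((k + 2) + n + ((k + 2) - n) * s) * n))).sub (i0.const_mul (n * (k + 1)))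
  have h := intervalIntegral.integral_eq_sub_of_hasDerivAt hderiv hint
  rw [intervalIntegral.integral_sub ((i2.const_mul _).add (i1.const_mul _)) (i0.const_mul _),
    intervalIntegral.integral_add (i2.const_mul _) (i1.const_mul _),
    intervalIntegral.integral_const_mul, intervalIntegral.integral_const_mul,
    intervalIntegral.integral_const_mul] at h
  have h0 : (0 : ℝ) ^ (n + 1) = 0 := Real.zero_rpow (by linarith)
  simp only [sub_self, h0, mul_zero, zero_mul, zero_pow (Nat.succ_ne_zero k), sub_zero] at h
  simp only [eulerIntegral]
  linarith

/-- Integrate `t(1+s) ≤ 1 + ts ≤ 1 + s`, raised to the power `n`, against the nonnegative weight. -/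
theorem eulerIntegral_bounds (k : ℕ) {n : ℝ} (hn : 0 ≤ n) :
    ∃ c C : ℝ, 0 < c ∧ ∀ s, 0 ≤ s →
      c * (1 + s) ^ n ≤ eulerIntegral (fun t => t ^ k * (1 - t) ^ n) n s ∧
      eulerIntegral (fun t => t ^ k * (1 - t) ^ n) n s ≤ C * (1 + s) ^ n := by
  set φ : ℝ → ℝ := fun t => t ^ k * (1 - t) ^ n with hφdef
  have hφ : Continuous φ := by
    have : Continuous fun t : ℝ => (1 - t) ^ n := Continuous.rpow_const (by fun_prop) fun _ => Or.inr hn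
    fun_prop
  have hφ0 : ∀ t ∈ Icc (0 : ℝ) 1, 0 ≤ φ t := fun t ht =>
    mul_nonneg (pow_nonneg ht.1 _) (Real.rpow_nonneg (by linarith [ht.2]) _)
  have hcn : Continuous fun t : ℝ => φ t * t ^ n :=
    hφ.mul (continuous_id.rpow_const fun _ => Or.inr hn)
  refine ⟨∫ t in (0 : ℝ)..1, φ t * t ^ n, ∫ t in (0 : ℝ)..1, φ t, ?_, fun s hs => ⟨?_, ?_⟩⟩
  · refine intervalIntegral.intervalIntegral_pos_of_pos_on (hcn.intervalIntegrable _ _)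
      (fun t ht => ?_) zero_lt_one
    have h1 : 0 < 1 - t := by linarith [ht.2]
    have := ht.1
    positivity
  · rw [← intervalIntegral.integral_mul_const]
    refine intervalIntegral.integral_mono_on zero_le_one
      ((hcn.intervalIntegrable _ _).mul_const _)
      (intervalIntegrable_eulerIntegrand hφ n (by linarith)) fun t ht => ?_
    rw [mul_assoc, ← Real.mul_rpow ht.1 (by linarith)]
    refine mul_le_mul_of_nonneg_left (Real.rpow_le_rpow (mul_nonneg ht.1 (by linarith)) ?_ hn)
      (hφ0 t ht)
    linarith [ht.2]
  · rw [← intervalIntegral.integral_mul_const]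
    refine intervalIntegral.integral_mono_on zero_le_one
      (intervalIntegrable_eulerIntegrand hφ n (by linarith))
      ((hφ.intervalIntegrable _ _).mul_const _) fun t ht => ?_
    refine mul_le_mul_of_nonneg_left (Real.rpow_le_rpow
      (one_add_mul_pos ht (by linarith)).le ?_ hn) (hφ0 t ht)
    nlinarith [ht.2]

/-- Factor of the regular radial solution of angular degree `k`, as a function of `s = r^2`. -/
noncomputable def radialFactor (N : ℕ) : ℕ → ℝ → ℝ
  | 0 => fun s => 1 - s
  | 1 => fun _ => 1
  | k + 2 => eulerIntegral (fun t => t ^ k * (1 - t) ^ ((N : ℝ) / 2)) ((N : ℝ) / 2)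

/-- The regular radial solution of angular degree `k`, divided by `r^k`, as a function of
`s = r^2`. -/
noncomputable def radialProfile (N k : ℕ) (s : ℝ) : ℝ :=
  (1 + s) ^ (-((N : ℝ) / 2)) * radialFactor N k s

theorem continuous_eulerWeight (N k : ℕ) :
    Continuous fun t : ℝ => t ^ k * (1 - t) ^ ((N : ℝ) / 2) :=
  (continuous_pow k).mul (Continuous.rpow_const (by fun_prop) fun _ => Or.inr (by positivity))

theorem contDiffOn_radialFactor (N k : ℕ) : ContDiffOn ℝ ∞ (radialFactor N k) (Ioi (-1)) := by
  match k with
  | 0 => exact (contDiff_const.sub contDiff_id).contDiffOn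
  | 1 => exact contDiff_const.contDiffOn
  | k + 2 => exact contDiffOn_eulerIntegral (continuous_eulerWeight N k) _

/-- This is the hypergeometric equation in `z = -s` with parameters `a = -N/2`, `b = k - 1`, `c = k
+ N/2`. Euler's integral needs `b > 0`, whence the separate cases `k = 0, 1`, where the series
terminates. -/
theorem radialFactor_ode (N k : ℕ) {s : ℝ} (hs : -1 < s) : ∃ J₁ : ℝ → ℝ, ∃ J₂ : ℝ,
    (∀ x, -1 < x → HasDerivAt (radialFactor N k) (J₁ x) x) ∧ HasDerivAt J₁ J₂ s ∧
    s * (1 + s) * J₂ + (k + (N : ℝ) / 2 + (k - (N : ℝ) / 2) * s) * J₁ s -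
      (N : ℝ) / 2 * (k - 1) * radialFactor N k s = 0 := by
  match k with
  | 0 =>
    refine ⟨fun _ => -1, 0, fun x _ => (hasDerivAt_id x).const_sub 1,
      hasDerivAt_const _ _, ?_⟩
    simp only [radialFactor]
    push_cast
    ring
  | 1 =>
    refine ⟨fun _ => 0, 0, fun x _ => hasDerivAt_const _ _, hasDerivAt_const _ _, ?_⟩
    simp
  | k + 2 =>
    have hφ := continuous_eulerWeight N k
    have hφ₁ : Continuous fun t : ℝ => t ^ k * (1 - t) ^ ((N : ℝ) / 2) * t := hφ.mul continuous_id
    refine ⟨_, _, fun x hx => hasDerivAt_eulerIntegral hφ _ hx,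
      (hasDerivAt_eulerIntegral hφ₁ _ hs).const_mul _, ?_⟩
    have h := eulerIntegral_ode k (n := (N : ℝ) / 2) (by positivity) hs
    simp only [radialFactor] at h ⊢
    push_cast
    rw [← h]
    ring

theorem contDiffOn_radialProfile (N k : ℕ) :
    ContDiffOn ℝ ∞ (radialProfile N k) (Ioi (-1)) := by
  refine ContDiffOn.mul (ContDiffOn.rpow_const_of_ne (by fun_prop) fun s hs => ?_)
    (contDiffOn_radialFactor N k)
  have : -1 < s := hs
  linarith

/-- The equation for `F(|x|²) P(x)` in the variable `s = |x|²`. Conjugation by `(1+s)^(-N/2)`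
reduces it to `4 (1+s)^(-N/2-1)` times the hypergeometric equation. -/
theorem radialProfile_ode (N k : ℕ) {s : ℝ} (hs : -1 < s) : ∃ F₁ : ℝ → ℝ, ∃ F₂ : ℝ,
    (∀ x, -1 < x → HasDerivAt (radialProfile N k) (F₁ x) x) ∧ HasDerivAt F₁ F₂ s ∧
    4 * s * F₂ + (2 * N + 4 * k) * F₁ s +
      N * (N + 2) / (1 + s) ^ 2 * radialProfile N k s = 0 := by
  obtain ⟨J₁, J₂, h1, h2, h3⟩ := radialFactor_ode N k hs
  set n : ℝ := (N : ℝ) / 2 with hn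
  have hpow : ∀ (m x : ℝ), -1 < x →
      HasDerivAt (fun x : ℝ => (1 + x) ^ m) (m * (1 + x) ^ (m - 1)) x := fun m x hx => by
    have := ((hasDerivAt_id x).const_add 1).rpow_const (p := m)
      (Or.inl (by simp only [id]; linarith))
    simpa using this
  have hs0 : 1 + s ≠ 0 := by linarith
  refine ⟨_, _, fun x hx => (hpow (-n) x hx).mul (h1 x hx),
    (((hpow (-n - 1) s hs).const_mul (-n)).mul (h1 s hs)).add ((hpow (-n) s hs).mul h2), ?_⟩
  have e1 : (1 + s) ^ (-n) = (1 + s) ^ (-n - 1 - 1) * (1 + s) * (1 + s) := by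
    rw [← Real.rpow_add_one hs0, ← Real.rpow_add_one hs0]; congr 1; ring
  have e2 : (1 + s) ^ (-n - 1) = (1 + s) ^ (-n - 1 - 1) * (1 + s) := by
    rw [← Real.rpow_add_one hs0]; congr 1; ring
  have hN : (N : ℝ) = 2 * n := by rw [hn]; ring
  have hr : radialProfile N k s = (1 + s) ^ (-n) * radialFactor N k s := rfl
  rw [hr, e1, e2, hN]
  have : 4 * (1 + s) ^ (-n - 1 - 1) * (1 + s) * (s * (1 + s) * J₂ + (k + n + (k - n) * s) * J₁ s -
      n * (k - 1) * radialFactor N k s) = 0 := by rw [h3, mul_zero]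
  rw [← this]
  generalize (1 + s) ^ (-n - 1 - 1) = w
  field_simp
  ring

theorem radialProfile_bounds (N : ℕ) {k : ℕ} (hk : 2 ≤ k) : ∃ c C : ℝ, 0 < c ∧ 0 < C ∧
    ∀ s, 0 ≤ s → c ≤ radialProfile N k s ∧ radialProfile N k s ≤ C := by
  obtain ⟨k, rfl⟩ := Nat.exists_eq_add_of_le' hk
  obtain ⟨c, C, hc, h⟩ := eulerIntegral_bounds k (n := (N : ℝ) / 2) (by positivity)
  have key : ∀ s, 0 ≤ s → c ≤ radialProfile N (k + 2) s ∧ radialProfile N (k + 2) s ≤ C := by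
    intro s hs
    have hpos : 0 < (1 + s) ^ ((N : ℝ) / 2) := Real.rpow_pos_of_pos (by linarith) _
    rw [radialProfile, Real.rpow_neg (by linarith), inv_mul_eq_div, le_div_iff₀ hpos,
      div_le_iff₀ hpos]
    exact h s hs
  have := key 0 le_rfl
  exact ⟨c, C, hc, by linarith, key⟩

theorem radialProfile_zero (N : ℕ) (s : ℝ) :
    radialProfile N 0 s = (1 + s) ^ (-((N : ℝ) / 2)) * (1 - s) := rfl

theorem radialProfile_one (N : ℕ) (s : ℝ) :
    radialProfile N 1 s = (1 + s) ^ (-((N : ℝ) / 2)) := mul_one _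

end Radial

open MeasureTheory

/-! ### Polynomials as smooth functions. -/

section PolynomialFunction

variable {N : ℕ}

/-- The function on `ℝ^N` defined by a polynomial. -/
noncomputable def polyFun (P : MvPolynomial (Fin N) ℝ) (x : EuclideanSpace ℝ (Fin N)) : ℝ :=
  MvPolynomial.eval (fun i => x i) P

theorem contDiff_polyFun (P : MvPolynomial (Fin N) ℝ) {n : WithTop ℕ∞} :
    ContDiff ℝ n (polyFun P) := by
  induction P using MvPolynomial.induction_on with
  | C a =>
    have : polyFun (MvPolynomial.C a : MvPolynomial (Fin N) ℝ) = fun _ => a := by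
      ext; simp [polyFun]
    rw [this]
    exact contDiff_const
  | add p q hp hq =>
    have : polyFun (p + q) = fun x => polyFun p x + polyFun q x := by ext; simp [polyFun]
    rw [this]
    exact hp.add hq
  | mul_X p i hp =>
    have : polyFun (p * MvPolynomial.X i) = fun x => polyFun p x * x i := by ext; simp [polyFun]
    rw [this]
    exact hp.mul (by fun_prop)

theorem hasFDerivAt_polyFun (P : MvPolynomial (Fin N) ℝ) (x : EuclideanSpace ℝ (Fin N)) :
    HasFDerivAt (polyFun P) (∑ i, polyFun (MvPolynomial.pderiv i P) x •
      (EuclideanSpace.proj i : EuclideanSpace ℝ (Fin N) →L[ℝ] ℝ)) x := by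
  classical
  induction P using MvPolynomial.induction_on with
  | C a =>
    have : polyFun (MvPolynomial.C a : MvPolynomial (Fin N) ℝ) = fun _ => a := by
      ext; simp [polyFun]
    rw [this]
    refine (hasFDerivAt_const a x).congr_fderiv ?_
    simp [polyFun]
  | add p q hp hq =>
    have : polyFun (p + q) = fun x => polyFun p x + polyFun q x := by ext; simp [polyFun]
    rw [this]
    refine (hp.add hq).congr_fderiv ?_
    simp [polyFun, add_smul, Finset.sum_add_distrib]
  | mul_X p j hp =>
    have : polyFun (p * MvPolynomial.X j) = fun x => polyFun p x * x j := by ext; simp [polyFun]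
    rw [this]
    refine (hp.mul ((EuclideanSpace.proj j : EuclideanSpace ℝ (Fin N) →L[ℝ] ℝ).hasFDerivAt
      (x := x))).congr_fderiv ?_
    ext y
    simp only [polyFun, Derivation.leibniz, MvPolynomial.pderiv_X, Pi.single_apply, smul_eq_mul,
      map_add, map_mul, MvPolynomial.eval_X, apply_ite, map_one, map_zero, add_smul, add_apply,
      Finset.sum_add_distrib, sum_apply, smul_apply, Finset.smul_sum]
    simp [mul_assoc]

theorem fderiv_polyFun_single (P : MvPolynomial (Fin N) ℝ) (x : EuclideanSpace ℝ (Fin N))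
    (i : Fin N) : fderiv ℝ (polyFun P) x (EuclideanSpace.single i 1) =
      polyFun (MvPolynomial.pderiv i P) x := by
  classical
  rw [(hasFDerivAt_polyFun P x).fderiv]
  simp

theorem polyFun_smul {P : MvPolynomial (Fin N) ℝ} {k : ℕ} (hP : P.IsHomogeneous k) (r : ℝ)
    (x : EuclideanSpace ℝ (Fin N)) : polyFun P (r • x) = r ^ k * polyFun P x := by
  simp only [polyFun, MvPolynomial.eval_eq, Finset.mul_sum]
  refine Finset.sum_congr rfl fun d hd => ?_
  have hdeg : ∑ i ∈ d.support, d i = k := by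
    simpa [Finsupp.weight_apply, Finsupp.sum] using hP (MvPolynomial.mem_support_iff.mp hd)
  simp only [PiLp.smul_apply, smul_eq_mul, mul_pow, Finset.prod_mul_distrib,
    Finset.prod_pow_eq_pow_sum, hdeg]
  ring

theorem sum_mul_polyFun_pderiv {P : MvPolynomial (Fin N) ℝ} {k : ℕ} (hP : P.IsHomogeneous k)
    (x : EuclideanSpace ℝ (Fin N)) :
    ∑ i, x i * polyFun (MvPolynomial.pderiv i P) x = k * polyFun P x := by
  have := congrArg (fun q => polyFun q x) hP.sum_X_mul_pderiv
  simpa [polyFun] using this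

theorem sum_polyFun_pderiv_pderiv {P : MvPolynomial (Fin N) ℝ} {k : ℕ}
    (hP : P ∈ harmonicSubmodule N k) (x : EuclideanSpace ℝ (Fin N)) :
    ∑ i, polyFun (MvPolynomial.pderiv i (MvPolynomial.pderiv i P)) x = 0 := by
  have := congrArg (fun q => polyFun q x) (MvPolynomial.mem_harmonicSubmodule.mp hP).2
  simpa [polyFun] using this

end PolynomialFunction

/-! ### Laplacian of a radial function times a harmonic polynomial. -/

section Laplacian

variable {N : ℕ}

theorem fderiv_apply_self_eq_sum (f : EuclideanSpace ℝ (Fin N) → ℝ)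
    (x y : EuclideanSpace ℝ (Fin N)) :
    fderiv ℝ f x y = ∑ i, y i * fderiv ℝ f x (EuclideanSpace.single i 1) := by
  conv_lhs => rw [← (EuclideanSpace.basisFun (Fin N) ℝ).sum_repr y]
  simp

theorem laplacian_eq_sum_fderiv {f : EuclideanSpace ℝ (Fin N) → ℝ} (hf : ContDiff ℝ 2 f)
    (x : EuclideanSpace ℝ (Fin N)) :
    Δ f x = ∑ i, fderiv ℝ (fun y => fderiv ℝ f y (EuclideanSpace.single i 1)) x
      (EuclideanSpace.single i 1) := by
  rw [InnerProductSpace.laplacian_eq_iteratedFDeriv_orthonormalBasis f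
    (EuclideanSpace.basisFun (Fin N) ℝ)]
  refine Finset.sum_congr rfl fun i _ => ?_
  have hd : DifferentiableAt ℝ (fderiv ℝ f) x :=
    ((hf.fderiv_right (m := 1) (by norm_num)).differentiable (by norm_num)) x
  rw [iteratedFDeriv_two_apply, fderiv_clm_apply hd (differentiableAt_const _)]
  simp

theorem contDiff_fderiv_single {f : EuclideanSpace ℝ (Fin N) → ℝ} (hf : ContDiff ℝ 2 f)
    (i : Fin N) : ContDiff ℝ 1 fun y => fderiv ℝ f y (EuclideanSpace.single i 1) :=
  (hf.fderiv_right (m := 1) (by norm_num)).clm_apply contDiff_const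

theorem hasFDerivAt_comp_norm_sq {F : ℝ → ℝ} {F' : ℝ} {x : EuclideanSpace ℝ (Fin N)}
    (hF : HasDerivAt F F' (‖x‖ ^ 2)) :
    HasFDerivAt (fun y : EuclideanSpace ℝ (Fin N) => F (‖y‖ ^ 2)) (F' • (2 • innerSL ℝ x)) x :=
  hF.comp_hasFDerivAt x (hasStrictFDerivAt_norm_sq x).hasFDerivAt

theorem contDiff_comp_norm_sq_mul_polyFun {F : ℝ → ℝ} (hF : ContDiffOn ℝ ∞ F (Set.Ioi (-1)))
    (P : MvPolynomial (Fin N) ℝ) :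
    ContDiff ℝ ∞ fun x : EuclideanSpace ℝ (Fin N) => F (‖x‖ ^ 2) * polyFun P x := by
  refine ContDiff.mul ?_ (contDiff_polyFun P)
  rw [← contDiffOn_univ]
  refine hF.comp (contDiff_norm_sq ℝ).contDiffOn fun x _ => ?_
  have : 0 ≤ ‖x‖ ^ 2 := by positivity
  simp only [Set.mem_Ioi]
  linarith

theorem laplacian_comp_norm_sq_mul_polyFun {F F₁ : ℝ → ℝ} {F₂ : ℝ} {k : ℕ}
    {P : MvPolynomial (Fin N) ℝ} (hP : P ∈ harmonicSubmodule N k)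
    (hF : ContDiffOn ℝ ∞ F (Set.Ioi (-1)))
    (x : EuclideanSpace ℝ (Fin N)) (h₁ : ∀ s, -1 < s → HasDerivAt F (F₁ s) s)
    (h₂ : HasDerivAt F₁ F₂ (‖x‖ ^ 2)) :
    Δ (fun x : EuclideanSpace ℝ (Fin N) => F (‖x‖ ^ 2) * polyFun P x) x =
      (4 * ‖x‖ ^ 2 * F₂ + (2 * N + 4 * k) * F₁ (‖x‖ ^ 2)) * polyFun P x := by
  have hpos : ∀ y : EuclideanSpace ℝ (Fin N), -1 < ‖y‖ ^ 2 := fun y => by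
    have : 0 ≤ ‖y‖ ^ 2 := by positivity
    linarith
  rw [laplacian_eq_sum_fderiv ((contDiff_comp_norm_sq_mul_polyFun hF P).of_le (by norm_cast))]
  have hd : ∀ i : Fin N, (fun y => fderiv ℝ
      (fun x : EuclideanSpace ℝ (Fin N) => F (‖x‖ ^ 2) * polyFun P x) y
      (EuclideanSpace.single i 1)) = fun y => F (‖y‖ ^ 2) * polyFun (MvPolynomial.pderiv i P) y +
        F₁ (‖y‖ ^ 2) * (2 * (y i * polyFun P y)) := by
    intro i
    ext y
    refine (congrArg (fun L : EuclideanSpace ℝ (Fin N) →L[ℝ] ℝ => L (EuclideanSpace.single i 1))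
      ((hasFDerivAt_comp_norm_sq (h₁ _ (hpos y))).mul ((contDiff_polyFun P (n := 1)).differentiable
        (by norm_num) y).hasFDerivAt).fderiv).trans ?_
    simp only [add_apply, smul_apply,
      fderiv_polyFun_single, innerSL_apply_apply, EuclideanSpace.inner_single_right, smul_eq_mul,
      nsmul_eq_mul]
    simp
    ring
  have hdd : ∀ i : Fin N, fderiv ℝ (fun y => F (‖y‖ ^ 2) * polyFun (MvPolynomial.pderiv i P) y +
        F₁ (‖y‖ ^ 2) * (2 * (y i * polyFun P y))) x (EuclideanSpace.single i 1) =
      F (‖x‖ ^ 2) * polyFun (MvPolynomial.pderiv i (MvPolynomial.pderiv i P)) x +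
        4 * F₁ (‖x‖ ^ 2) * (x i * polyFun (MvPolynomial.pderiv i P) x) +
        4 * F₂ * polyFun P x * (x i * x i) + 2 * F₁ (‖x‖ ^ 2) * polyFun P x := by
    intro i
    have hx : HasFDerivAt (fun y : EuclideanSpace ℝ (Fin N) => y i)
        (EuclideanSpace.proj i : EuclideanSpace ℝ (Fin N) →L[ℝ] ℝ) x :=
      (EuclideanSpace.proj i : EuclideanSpace ℝ (Fin N) →L[ℝ] ℝ).hasFDerivAt
    have hPd : ∀ Q : MvPolynomial (Fin N) ℝ, HasFDerivAt (polyFun Q) (fderiv ℝ (polyFun Q) x) x :=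
      fun Q => ((contDiff_polyFun Q (n := 1)).differentiable (by norm_num) x).hasFDerivAt
    have h := ((hasFDerivAt_comp_norm_sq (h₁ _ (hpos x))).mul (hPd (MvPolynomial.pderiv i P))).add
      ((hasFDerivAt_comp_norm_sq h₂).mul ((hx.mul (hPd P)).const_mul 2))
    refine (congrArg (fun L : EuclideanSpace ℝ (Fin N) →L[ℝ] ℝ => L (EuclideanSpace.single i 1))
      h.fderiv).trans ?_
    simp only [add_apply, smul_apply,
      fderiv_polyFun_single, innerSL_apply_apply, EuclideanSpace.inner_single_right, smul_eq_mul,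
      nsmul_eq_mul]
    simp
    ring
  simp only [hd, hdd, Finset.sum_add_distrib, ← Finset.mul_sum, sum_polyFun_pderiv_pderiv hP,
    sum_mul_polyFun_pderiv hP.1]
  have hn : ∑ i, x i * x i = ‖x‖ ^ 2 := by
    rw [EuclideanSpace.real_norm_sq_eq]
    exact Finset.sum_congr rfl fun i _ => (sq _).symm
  rw [hn]
  simp
  ring

end Laplacian

/-! ### Green's identity against radial test functions. -/

section Green

variable {N : ℕ}

theorem integral_fderiv_eq_zero_of_hasCompactSupport {f : EuclideanSpace ℝ (Fin N) → ℝ}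
    (hf : ContDiff ℝ 1 f) (hc : HasCompactSupport f) (v : EuclideanSpace ℝ (Fin N)) :
    ∫ x, fderiv ℝ f x v = 0 := by
  have hi : Integrable fun x => fderiv ℝ f x v :=
    ((hf.continuous_fderiv (by norm_num)).clm_apply continuous_const).integrable_of_hasCompactSupport
      (hc.fderiv_apply ℝ v)
  have h := integral_mul_fderiv_eq_neg_fderiv_mul_of_integrable (𝕜 := ℝ) (μ := volume)
    (f := fun _ : EuclideanSpace ℝ (Fin N) => (1 : ℝ)) (g := f) (v := v)
    (by simp) (by simpa using hi) (by simpa using hf.continuous.integrable_of_hasCompactSupport hc)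
    (fun x _ => differentiableAt_const _) (fun x _ => hf.differentiable (by norm_num) x)
  simpa using h

/-- Integrate the divergence of `Φ(|x|²)(v∇u - u∇v)`, where `Φ' = φ`: the second-order terms cancel
by `h`, and the gradient of `Φ(|x|²)` contributes `2φ(|x|²) x`. The primitive based at `R` vanishes
beyond `R`, so the field has compact support and no boundary terms appear. -/
theorem integral_comp_norm_sq_mul_eq_zero {u v : EuclideanSpace ℝ (Fin N) → ℝ}
    (hu : ContDiff ℝ 2 u) (hv : ContDiff ℝ 2 v) (h : ∀ x, v x * Δ u x = u x * Δ v x)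
    {φ : ℝ → ℝ} (hφ : Continuous φ) {R : ℝ} (hR : ∀ s, R ≤ s → φ s = 0) :
    ∫ x : EuclideanSpace ℝ (Fin N), φ (‖x‖ ^ 2) * (v x * fderiv ℝ u x x - u x * fderiv ℝ v x x)
      = 0 := by
  set Φ : ℝ → ℝ := fun s => ∫ t in R..s, φ t with hΦ
  have hd : ∀ s, HasDerivAt Φ (φ s) s := fun s =>
    intervalIntegral.integral_hasDerivAt_right (hφ.intervalIntegrable _ _)
      hφ.aestronglyMeasurable.stronglyMeasurableAtFilter hφ.continuousAt
  have hΦ1 : ContDiff ℝ 1 Φ := by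
    rw [contDiff_one_iff_deriv]
    exact ⟨fun s => (hd s).differentiableAt, by rwa [funext fun s => (hd s).deriv]⟩
  have hΦ0 : ∀ s, R ≤ s → Φ s = 0 := fun s hs => by
    refine intervalIntegral.integral_zero_ae (Filter.Eventually.of_forall fun t ht => hR t ?_)
    rw [Set.uIoc_of_le hs] at ht
    exact ht.1.le
  set e : Fin N → EuclideanSpace ℝ (Fin N) := fun i => EuclideanSpace.single i 1 with he
  set G : Fin N → EuclideanSpace ℝ (Fin N) → ℝ := fun i x =>
    v x * fderiv ℝ u x (e i) - u x * fderiv ℝ v x (e i) with hG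
  have hG1 : ∀ i, ContDiff ℝ 1 (G i) := fun i =>
    ((hv.of_le (by norm_num)).mul (contDiff_fderiv_single hu i)).sub
      ((hu.of_le (by norm_num)).mul (contDiff_fderiv_single hv i))
  have hF1 : ∀ i, ContDiff ℝ 1 fun x => Φ (‖x‖ ^ 2) * G i x := fun i =>
    (hΦ1.comp (contDiff_norm_sq ℝ)).mul (hG1 i)
  have hFc : ∀ i, HasCompactSupport fun x => Φ (‖x‖ ^ 2) * G i x := fun i => by
    refine HasCompactSupport.intro (isCompact_closedBall (0 : EuclideanSpace ℝ (Fin N)) (|R| + 1))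
      fun x hx => ?_
    rw [mem_closedBall_zero_iff, not_le] at hx
    rw [hΦ0 _ (by nlinarith [le_abs_self R, abs_nonneg R]), zero_mul]
  have hfd : ∀ i x, fderiv ℝ (fun x => Φ (‖x‖ ^ 2) * G i x) x (e i) =
      2 * φ (‖x‖ ^ 2) * (x i * G i x) + Φ (‖x‖ ^ 2) *
        (v x * fderiv ℝ (fun y => fderiv ℝ u y (e i)) x (e i) -
          u x * fderiv ℝ (fun y => fderiv ℝ v y (e i)) x (e i)) := by
    intro i x
    have hud := (hu.differentiable (by norm_num) x).hasFDerivAt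
    have hvd := (hv.differentiable (by norm_num) x).hasFDerivAt
    have hudd := ((contDiff_fderiv_single hu i).differentiable (by norm_num) x).hasFDerivAt
    have hvdd := ((contDiff_fderiv_single hv i).differentiable (by norm_num) x).hasFDerivAt
    have h := (hasFDerivAt_comp_norm_sq (hd (‖x‖ ^ 2))).mul ((hvd.mul hudd).sub (hud.mul hvdd))
    refine (congrArg (fun L : EuclideanSpace ℝ (Fin N) →L[ℝ] ℝ => L (e i)) h.fderiv).trans ?_
    simp only [add_apply, sub_apply,
      smul_apply, innerSL_apply_apply, smul_eq_mul, nsmul_eq_mul, hG, he,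
      EuclideanSpace.inner_single_right]
    simp
    ring
  have hsum : ∑ i, ∫ x, fderiv ℝ (fun x => Φ (‖x‖ ^ 2) * G i x) x (e i) = 0 :=
    Finset.sum_eq_zero fun i _ =>
      integral_fderiv_eq_zero_of_hasCompactSupport (hF1 i) (hFc i) (e i)
  rw [← integral_finsetSum _ fun i _ =>
    (((hF1 i).continuous_fderiv (by norm_num)).clm_apply
      continuous_const).integrable_of_hasCompactSupport ((hFc i).fderiv_apply ℝ (e i))] at hsum
  have hpt : ∀ x, ∑ i, fderiv ℝ (fun x => Φ (‖x‖ ^ 2) * G i x) x (e i) =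
      2 * (φ (‖x‖ ^ 2) * (v x * fderiv ℝ u x x - u x * fderiv ℝ v x x)) := by
    intro x
    simp only [hfd, Finset.sum_add_distrib, ← Finset.mul_sum, Finset.sum_sub_distrib]
    have e1 : ∑ i, x i * G i x = v x * fderiv ℝ u x x - u x * fderiv ℝ v x x := by
      rw [fderiv_apply_self_eq_sum u x x, fderiv_apply_self_eq_sum v x x, Finset.mul_sum,
        Finset.mul_sum, ← Finset.sum_sub_distrib]
      exact Finset.sum_congr rfl fun i _ => by simp only [hG, he]; ring
    rw [← laplacian_eq_sum_fderiv hu, ← laplacian_eq_sum_fderiv hv, h x, e1]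
    ring
  simp only [hpt] at hsum
  rw [integral_const_mul] at hsum
  linarith

end Green

/-! ### From radial averages to individual spheres, by polar coordinates. -/

section Sphere

variable {E : Type*} [NormedAddCommGroup E] [NormedSpace ℝ E]
  [MeasurableSpace E] [BorelSpace E] [FiniteDimensional ℝ E]

theorem continuous_integral_sphere (μ : Measure E) [μ.IsAddHaarMeasure] {f : E → ℝ}
    (hf : Continuous f) :
    Continuous fun r : ℝ => ∫ ξ : Metric.sphere (0 : E) 1, f (r • (ξ : E)) ∂μ.toSphere := by
  have : Continuous (Function.uncurry fun (r : ℝ) (ξ : Metric.sphere (0 : E) 1) => f (r • (ξ : E))) := by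
    simp only [Function.uncurry_def]
    fun_prop
  simpa using continuous_parametric_integral_of_continuous (μ := μ.toSphere) this isCompact_univ

variable [Nontrivial E]

theorem integral_eq_integral_Ioi_integral_sphere (μ : Measure E) [μ.IsAddHaarMeasure] {f : E → ℝ}
    (hf : Integrable f μ) :
    ∫ x, f x ∂μ = ∫ r in Set.Ioi (0 : ℝ), r ^ (Module.finrank ℝ E - 1) *
      ∫ ξ : Metric.sphere (0 : E) 1, f (r • (ξ : E)) ∂μ.toSphere := by
  set g : Metric.sphere (0 : E) 1 × Set.Ioi (0 : ℝ) → ℝ := fun z => f ((z.2 : ℝ) • (z.1 : E)) with hg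
  have hgx : ∀ x : ({(0)}ᶜ : Set E), g (homeomorphUnitSphereProd E x) = f x := fun x => by
    have hx : ‖(x : E)‖ ≠ 0 := norm_ne_zero_iff.mpr x.2
    simp [hg, smul_smul, hx]
  have hmp := μ.measurePreserving_homeomorphUnitSphereProd
  have hemb := (homeomorphUnitSphereProd E).measurableEmbedding
  have hint : Integrable g (μ.toSphere.prod (.volumeIoiPow (Module.finrank ℝ E - 1))) := by
    rw [← hmp.integrable_comp_emb hemb]
    have : Integrable (fun x : ({(0)}ᶜ : Set E) => f x) (μ.comap (↑)) :=
      (integrableOn_iff_comap_subtypeVal (measurableSet_singleton _).compl).mp hf.integrableOn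
    exact this.congr (Filter.Eventually.of_forall fun x => (hgx x).symm)
  calc
    ∫ x, f x ∂μ = ∫ x : ({(0)}ᶜ : Set E), f x ∂(μ.comap (↑)) := by
      rw [integral_subtype_comap (measurableSet_singleton _).compl fun x ↦ f x,
        restrict_compl_singleton]
    _ = ∫ z, g z ∂μ.toSphere.prod (.volumeIoiPow (Module.finrank ℝ E - 1)) := by
      rw [← hmp.integral_comp hemb g]
      simp only [hgx]
    _ = ∫ r : Set.Ioi (0 : ℝ), ∫ ξ, g (ξ, r) ∂μ.toSphere
          ∂.volumeIoiPow (Module.finrank ℝ E - 1) := integral_prod_symm _ hint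
    _ = _ := by
      simp only [Measure.volumeIoiPow, ENNReal.ofReal]
      rw [integral_withDensity_eq_integral_smul,
        integral_subtype_comap measurableSet_Ioi fun a ↦ Real.toNNReal
          (a ^ (Module.finrank ℝ E - 1)) • ∫ ξ : Metric.sphere (0 : E) 1, f (a • (ξ : E)) ∂μ.toSphere,
        setIntegral_congr_fun measurableSet_Ioi fun x hx ↦ ?_]
      · rw [NNReal.smul_def, Real.coe_toNNReal _ (pow_nonneg hx.out.le _), smul_eq_mul]
      · exact (measurable_subtype_coe.pow_const _).real_toNNReal

theorem integral_sphere_eq_zero_of_forall (μ : Measure E) [μ.IsAddHaarMeasure] {f : E → ℝ}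
    (hf : Continuous f)
    (h : ∀ φ : ℝ → ℝ, Continuous φ → (∃ R, ∀ s, R ≤ s → φ s = 0) → ∫ x, φ (‖x‖ ^ 2) * f x ∂μ = 0)
    {r : ℝ} (hr : 0 < r) :
    ∫ ξ : Metric.sphere (0 : E) 1, f (r • (ξ : E)) ∂μ.toSphere = 0 := by
  set g : ℝ → ℝ := fun r => ∫ ξ : Metric.sphere (0 : E) 1, f (r • (ξ : E)) ∂μ.toSphere with hg
  have hgc : Continuous g := continuous_integral_sphere μ hf
  set χ : ℝ → ℝ := fun t => max 0 (r - |t - r|) with hχ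
  have hχc : Continuous χ := by fun_prop
  have hχ0 : ∀ t, 2 * r ≤ t → χ t = 0 := fun t ht => by
    simp only [hχ]
    rw [abs_of_nonneg (by linarith)]
    exact max_eq_left (by linarith)
  have hχ1 : ∀ t, t ≤ 0 → χ t = 0 := fun t ht => by
    simp only [hχ]
    rw [abs_of_nonpos (by linarith)]
    exact max_eq_left (by linarith)
  -- Testing with a tent around `r` times the spherical mean `g` itself yields the integral of `t^d
  -- χ g²`, which would be positive if `g r ≠ 0`.
  set φ : ℝ → ℝ := fun s => χ (√s) * g (√s) with hφ
  have hφc : Continuous φ := by fun_prop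
  have hφR : ∀ s, (2 * r) ^ 2 ≤ s → φ s = 0 := fun s hs => by
    simp only [hφ]
    rw [hχ0 _ (Real.le_sqrt_of_sq_le hs), zero_mul]
  have hint : Integrable (fun x => φ (‖x‖ ^ 2) * f x) μ := by
    refine Continuous.integrable_of_hasCompactSupport (by fun_prop) ?_
    refine HasCompactSupport.intro (isCompact_closedBall (0 : E) (2 * r)) fun x hx => ?_
    rw [mem_closedBall_zero_iff, not_le] at hx
    rw [hφR _ (by gcongr), zero_mul]
  have h0 := h φ hφc ⟨_, hφR⟩
  rw [integral_eq_integral_Ioi_integral_sphere μ hint] at h0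
  set d := Module.finrank ℝ E - 1
  have h1 : ∀ t ∈ Set.Ioi (0 : ℝ), t ^ d * ∫ ξ : Metric.sphere (0 : E) 1,
      φ (‖t • (ξ : E)‖ ^ 2) * f (t • (ξ : E)) ∂μ.toSphere = t ^ d * (χ t * g t ^ 2) := by
    intro t ht
    have ht' : 0 ≤ t := le_of_lt ht
    have : ∀ ξ : Metric.sphere (0 : E) 1, φ (‖t • (ξ : E)‖ ^ 2) = χ t * g t := fun ξ => by
      simp [hφ, norm_smul, abs_of_nonneg ht', Real.sqrt_sq ht']
    simp only [this]
    rw [integral_const_mul]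
    simp only [hg]
    ring
  rw [setIntegral_congr_fun measurableSet_Ioi h1,
    setIntegral_eq_integral_of_forall_compl_eq_zero fun t ht => by
      rw [hχ1 t (not_lt.mp ht), zero_mul, mul_zero]] at h0
  by_contra hne
  have hpos : 0 < ∫ t : ℝ, t ^ d * (χ t * g t ^ 2) := by
    refine Continuous.integral_pos_of_hasCompactSupport_nonneg_nonzero (x := r) (by fun_prop)
      ?_ (fun t => ?_) ?_
    · refine HasCompactSupport.intro (isCompact_Icc (a := 0) (b := 2 * r)) fun t ht => ?_
      rw [Set.mem_Icc, not_and_or, not_le, not_le] at ht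
      rcases ht with ht | ht
      · rw [hχ1 t ht.le, zero_mul, mul_zero]
      · rw [hχ0 t ht.le, zero_mul, mul_zero]
    · rcases le_total t 0 with ht | ht
      · simp [hχ1 t ht]
      · have : 0 ≤ χ t := le_max_left _ _
        simp only [Pi.zero_apply]
        positivity
    · have : χ r = r := by simp [hχ, hr.le]
      rw [this]
      have hg0 : g r ≠ 0 := hne
      positivity
  linarith

end Sphere

theorem integral_sphere_wronskian_eq_zero {N : ℕ} (hN : 0 < N)
    {u v : EuclideanSpace ℝ (Fin N) → ℝ}
    (hu : ContDiff ℝ 2 u) (hv : ContDiff ℝ 2 v) (h : ∀ x, v x * Δ u x = u x * Δ v x)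
    {r : ℝ} (hr : 0 < r) :
    ∫ ξ : Metric.sphere (0 : EuclideanSpace ℝ (Fin N)) 1,
      (v (r • (ξ : EuclideanSpace ℝ (Fin N))) * fderiv ℝ u (r • (ξ : EuclideanSpace ℝ (Fin N))) ξ -
        u (r • (ξ : EuclideanSpace ℝ (Fin N))) * fderiv ℝ v (r • (ξ : EuclideanSpace ℝ (Fin N))) ξ)
      ∂(volume : Measure (EuclideanSpace ℝ (Fin N))).toSphere = 0 := by
  have : Nonempty (Fin N) := ⟨⟨0, hN⟩⟩
  have hcont : ∀ {w : EuclideanSpace ℝ (Fin N) → ℝ}, ContDiff ℝ 2 w →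
      Continuous fun x => fderiv ℝ w x x := fun hw =>
    (hw.continuous_fderiv (by norm_num)).clm_apply continuous_id
  have key := integral_sphere_eq_zero_of_forall (volume : Measure (EuclideanSpace ℝ (Fin N)))
    (f := fun x => v x * fderiv ℝ u x x - u x * fderiv ℝ v x x)
    ((hv.continuous.mul (hcont hu)).sub (hu.continuous.mul (hcont hv)))
    (fun φ hφ ⟨R, hR⟩ => integral_comp_norm_sq_mul_eq_zero hu hv h hφ hR) hr
  simp only [map_smul, smul_eq_mul, mul_left_comm _ r, ← mul_sub, integral_const_mul] at key
  exact (mul_eq_zero.mp key).resolve_left (ne_of_gt hr)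

/-- The unit sphere of `ℝ^N`. -/
abbrev UnitSphere (N : ℕ) : Type := Metric.sphere (0 : EuclideanSpace ℝ (Fin N)) 1

/-- The surface measure of the unit sphere of `ℝ^N`. -/
noncomputable abbrev surfaceMeasure (N : ℕ) : Measure (UnitSphere N) :=
  (volume : Measure (EuclideanSpace ℝ (Fin N))).toSphere

/-! ### Orthogonality and completeness of spherical harmonics. -/

section SphericalHarmonics

variable {N : ℕ}

theorem norm_smul_sphere_sq (r : ℝ) (ξ : UnitSphere N) :
    ‖r • (ξ : EuclideanSpace ℝ (Fin N))‖ ^ 2 = r ^ 2 := by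
  simp [norm_smul]

theorem continuous_polyFun (P : MvPolynomial (Fin N) ℝ) : Continuous (polyFun P) :=
  (contDiff_polyFun P (n := 0)).continuous

theorem Continuous.integrable_unitSphere {g : UnitSphere N → ℝ} (hg : Continuous g) :
    Integrable g (surfaceMeasure N) :=
  hg.integrable_of_hasCompactSupport (HasCompactSupport.of_compactSpace g)

theorem laplacian_polyFun_eq_zero {k : ℕ} {P : MvPolynomial (Fin N) ℝ}
    (hP : P ∈ harmonicSubmodule N k) (x : EuclideanSpace ℝ (Fin N)) : Δ (polyFun P) x = 0 := by
  have h := laplacian_comp_norm_sq_mul_polyFun (F := fun _ => 1) (F₁ := fun _ => 0) (F₂ := 0) hP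
    contDiffOn_const x (fun s _ => hasDerivAt_const _ _) (hasDerivAt_const _ _)
  simpa using h

theorem fderiv_polyFun_self {k : ℕ} {P : MvPolynomial (Fin N) ℝ} (hP : P.IsHomogeneous k)
    (x : EuclideanSpace ℝ (Fin N)) : fderiv ℝ (polyFun P) x x = k * polyFun P x := by
  rw [fderiv_apply_self_eq_sum, ← sum_mul_polyFun_pderiv hP]
  simp only [fderiv_polyFun_single]

/-- By Euler's identity the spherical Wronskian of two harmonic polynomials is `k - l` times their
product. -/
theorem integral_sphere_mul_eq_zero_of_ne (hN : 0 < N) {k l : ℕ} (hkl : k ≠ l)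
    {P Q : MvPolynomial (Fin N) ℝ} (hP : P ∈ harmonicSubmodule N k)
    (hQ : Q ∈ harmonicSubmodule N l) :
    ∫ ξ : UnitSphere N, polyFun P ξ * polyFun Q ξ ∂surfaceMeasure N = 0 := by
  have h := integral_sphere_wronskian_eq_zero hN (contDiff_polyFun P) (contDiff_polyFun Q)
    (fun x => by rw [laplacian_polyFun_eq_zero hP, laplacian_polyFun_eq_zero hQ]; ring) one_pos
  simp only [one_smul, fderiv_polyFun_self hP.1, fderiv_polyFun_self hQ.1] at h
  have e : ∀ ξ : UnitSphere N, polyFun Q ξ * (k * polyFun P ξ) - polyFun P ξ * (l * polyFun Q ξ) =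
      ((k : ℝ) - l) * (polyFun P ξ * polyFun Q ξ) := fun ξ => by ring
  simp only [e, integral_const_mul] at h
  exact (mul_eq_zero.mp h).resolve_left (sub_ne_zero.mpr (by exact_mod_cast hkl))

/-- Restriction of polynomials to the unit sphere. -/
noncomputable def sphereRestrict (N : ℕ) : MvPolynomial (Fin N) ℝ →ₐ[ℝ] C(UnitSphere N, ℝ) :=
  MvPolynomial.aeval fun i => ⟨fun ξ => (ξ : EuclideanSpace ℝ (Fin N)) i, by fun_prop⟩

theorem sphereRestrict_apply (P : MvPolynomial (Fin N) ℝ) (ξ : UnitSphere N) :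
    sphereRestrict N P ξ = polyFun P ξ := by
  induction P using MvPolynomial.induction_on with
  | C a => simp [sphereRestrict, polyFun]
  | add p q hp hq => simp_all [polyFun]
  | mul_X p i hp =>
    rw [map_mul, ContinuousMap.mul_apply, hp]
    simp [sphereRestrict, polyFun]

/-- The functional `P ↦ ∫ g P` over the unit sphere. -/
noncomputable def spherePairing (g : C(UnitSphere N, ℝ)) : MvPolynomial (Fin N) ℝ →ₗ[ℝ] ℝ where
  toFun P := ∫ ξ, g ξ * sphereRestrict N P ξ ∂surfaceMeasure N
  map_add' P Q := by
    simp only [map_add, ContinuousMap.add_apply, mul_add]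
    exact integral_add (by fun_prop : Continuous _).integrable_unitSphere
      (by fun_prop : Continuous _).integrable_unitSphere
  map_smul' a P := by
    simp only [map_smul, ContinuousMap.smul_apply, smul_eq_mul, mul_left_comm, integral_const_mul,
      RingHom.id_apply]

theorem spherePairing_apply (g : C(UnitSphere N, ℝ)) (P : MvPolynomial (Fin N) ℝ) :
    spherePairing g P = ∫ ξ, g ξ * polyFun P ξ ∂surfaceMeasure N := by
  simp only [spherePairing, LinearMap.coe_mk, AddHom.coe_mk, sphereRestrict_apply]

theorem sphereRestrict_normSqPoly : sphereRestrict N (normSqPoly N) = 1 := by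
  ext ξ
  have : ‖(ξ : EuclideanSpace ℝ (Fin N))‖ ^ 2 = 1 := by simp
  rw [EuclideanSpace.real_norm_sq_eq] at this
  simpa [sphereRestrict_apply, polyFun, normSqPoly] using this

/-- On the sphere the factors `|x|^(2j)` of the Fischer decomposition equal `1`, so every polynomial
restricts to a sum of harmonics. -/
theorem spherePairing_eq_zero (hN : 0 < N) {g : C(UnitSphere N, ℝ)}
    (hg : ∀ k, ∀ Q ∈ harmonicSubmodule N k, spherePairing g Q = 0) (P : MvPolynomial (Fin N) ℝ) :
    spherePairing g P = 0 := by
  have hle : ∀ d, fischerSpan N d ≤ LinearMap.ker (spherePairing g) := fun d => by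
    refine Submodule.span_le.mpr ?_
    rintro _ ⟨j, k, h, -, hh, rfl⟩
    have h0 := hg k h hh
    simp only [spherePairing, LinearMap.coe_mk, AddHom.coe_mk] at h0
    simp only [SetLike.mem_coe, LinearMap.mem_ker, spherePairing, LinearMap.coe_mk, AddHom.coe_mk,
      map_mul, map_pow, sphereRestrict_normSqPoly, one_pow, one_mul, h0]
  rw [← P.sum_homogeneousComponent, map_sum]
  exact Finset.sum_eq_zero fun d _ => LinearMap.mem_ker.mp
    (hle d (MvPolynomial.mem_fischerSpan_of_isHomogeneous hN d
      (MvPolynomial.homogeneousComponent_isHomogeneous d P)))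

/-- A continuous function on the sphere that is orthogonal to all spherical harmonics vanishes. -/
theorem eq_zero_of_orthogonal_harmonics (hN : 0 < N) {g : C(UnitSphere N, ℝ)}
    (hg : ∀ k, ∀ Q ∈ harmonicSubmodule N k, spherePairing g Q = 0) : g = 0 := by
  have hsep : (sphereRestrict N).range.SeparatesPoints := by
    intro ξ η hne
    have : ∃ i, (ξ : EuclideanSpace ℝ (Fin N)) i ≠ (η : EuclideanSpace ℝ (Fin N)) i := by
      by_contra! h
      exact hne (Subtype.ext (PiLp.ext h))
    obtain ⟨i, hi⟩ := this
    refine ⟨_, ⟨sphereRestrict N (MvPolynomial.X i), ⟨_, rfl⟩, rfl⟩, ?_⟩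
    simpa [sphereRestrict] using hi
  -- Since `g` is orthogonal to polynomials, `∫ g² = ∫ g (g - P)` for a uniform approximant `P`.
  have hle : ∀ ε : ℝ, 0 < ε →
      ∫ ξ, g ξ * g ξ ∂surfaceMeasure N ≤ ε * ∫ ξ, |g ξ| ∂surfaceMeasure N := by
    intro ε hε
    obtain ⟨⟨_, ⟨P, rfl⟩⟩, hP⟩ :=
      ContinuousMap.exists_mem_subalgebra_near_continuousMap_of_separatesPoints _ hsep g ε hε
    have h0 : ∫ ξ, g ξ * sphereRestrict N P ξ ∂surfaceMeasure N = 0 := spherePairing_eq_zero hN hg P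
    have h1 : ∫ ξ, g ξ * g ξ ∂surfaceMeasure N =
        ∫ ξ, (g ξ * g ξ - g ξ * sphereRestrict N P ξ) ∂surfaceMeasure N := by
      rw [integral_sub (by fun_prop : Continuous _).integrable_unitSphere
        (by fun_prop : Continuous _).integrable_unitSphere, h0, sub_zero]
    rw [h1, ← integral_const_mul]
    refine integral_mono (by fun_prop : Continuous _).integrable_unitSphere
      (by fun_prop : Continuous _).integrable_unitSphere fun ξ => ?_
    have h2 : |sphereRestrict N P ξ - g ξ| ≤ ε :=
      (ContinuousMap.norm_coe_le_norm (sphereRestrict N P - g) ξ).trans hP.le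
    calc g ξ * g ξ - g ξ * sphereRestrict N P ξ ≤ |g ξ * (sphereRestrict N P ξ - g ξ)| := by
          rw [← mul_sub, ← abs_neg, ← mul_neg, neg_sub]; exact le_abs_self _
      _ ≤ ε * |g ξ| := by rw [abs_mul, mul_comm]; gcongr
  have hint0 : ∫ ξ, g ξ * g ξ ∂surfaceMeasure N ≤ 0 := by
    have ht : Filter.Tendsto (fun ε : ℝ => ε * ∫ ξ, |g ξ| ∂surfaceMeasure N) (𝓝[>] 0) (𝓝 0) := by
      have : Continuous fun ε : ℝ => ε * ∫ ξ, |g ξ| ∂surfaceMeasure N := by fun_prop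
      simpa using (this.tendsto 0).mono_left nhdsWithin_le_nhds
    exact ge_of_tendsto ht (by filter_upwards [self_mem_nhdsWithin] with ε hε using hle ε hε)
  ext ξ
  by_contra hne
  have hpos : 0 < ∫ ξ, g ξ * g ξ ∂surfaceMeasure N :=
    Continuous.integral_pos_of_hasCompactSupport_nonneg_nonzero (x := ξ) (by fun_prop)
      (HasCompactSupport.of_compactSpace _) (fun ξ => mul_self_nonneg _) (mul_self_ne_zero.mpr hne)
  linarith

/-- Orthogonal projection onto the spherical harmonics of degree `k`. -/
theorem exists_harmonic_projection (g : C(UnitSphere N, ℝ)) (k : ℕ) :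
    ∃ Y ∈ harmonicSubmodule N k, ∀ Q ∈ harmonicSubmodule N k,
      spherePairing g Q = spherePairing (sphereRestrict N Y) Q := by
  have hfin : FiniteDimensional ℝ (harmonicSubmodule N k) := by
    have : FiniteDimensional ℝ (MvPolynomial.homogeneousSubmodule (Fin N) ℝ k) :=
      Module.Finite.iff_fg.mpr (MvPolynomial.homogeneousSubmodule_fg _ _ k)
    exact Submodule.finiteDimensional_of_le inf_le_left
  set T : MvPolynomial (Fin N) ℝ →ₗ[ℝ] Lp ℝ 2 (surfaceMeasure N) :=
    (ContinuousMap.toLp 2 (surfaceMeasure N) ℝ).toLinearMap ∘ₗ (sphereRestrict N).toLinearMap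
  obtain ⟨y, ⟨Y, hY, rfl⟩, z, hz, hyz⟩ := ((harmonicSubmodule N k).map T).exists_add_mem_mem_orthogonal
    (ContinuousMap.toLp 2 (surfaceMeasure N) ℝ g)
  refine ⟨Y, hY, fun Q hQ => ?_⟩
  have h := hz (T Q) ⟨Q, hQ, rfl⟩
  rw [← sub_eq_of_eq_add' hyz, inner_sub_right] at h
  have h1 := ContinuousMap.inner_toLp (𝕜 := ℝ) (surfaceMeasure N) (sphereRestrict N Q) g
  have h2 := ContinuousMap.inner_toLp (𝕜 := ℝ) (surfaceMeasure N) (sphereRestrict N Q)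
    (sphereRestrict N Y)
  simp only [conj_trivial] at h1 h2
  exact h1.symm.trans ((sub_eq_zero.mp h).trans h2)

end SphericalHarmonics

/-! ### Spherical coefficients of a solution. -/

section RadialPart

variable {N : ℕ}

/-- The regular radial solution of angular degree `k` of the linearized equation. -/
noncomputable def radialPart (N k : ℕ) (r : ℝ) : ℝ := r ^ k * radialProfile N k (r ^ 2)

theorem contDiff_radialPart (N k : ℕ) : ContDiff ℝ ∞ (radialPart N k) := by
  refine (contDiff_id.pow k).mul ?_
  rw [← contDiffOn_univ]
  refine (contDiffOn_radialProfile N k).comp (contDiff_id.pow 2).contDiffOn fun x _ => ?_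
  simp only [Set.mem_Ioi]
  nlinarith [sq_nonneg x]

theorem differentiable_radialPart (N k : ℕ) : Differentiable ℝ (radialPart N k) :=
  (contDiff_radialPart N k).differentiable (by norm_num)

theorem bubble_rpow_critExp_sub_one (hN : 3 ≤ N) (x : EuclideanSpace ℝ (Fin N)) :
    bubble N x ^ (critExp N - 1) = ((1 + ‖x‖ ^ 2) ^ 2)⁻¹ := by
  have hN' : (3 : ℝ) ≤ N := by exact_mod_cast hN
  have h2 : (N : ℝ) - 2 ≠ 0 := by linarith
  have hpos : 0 < 1 + ‖x‖ ^ 2 := by positivity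
  rw [bubble, critExp, ← Real.rpow_mul hpos.le,
    show -(((N : ℝ) - 2) / 2) * ((N + 2) / (N - 2) - 1) = -((2 : ℕ) : ℝ) by
      push_cast
      field_simp
      ring, Real.rpow_neg hpos.le, Real.rpow_natCast]

theorem laplacian_radialProfile_mul_polyFun {k : ℕ} {P : MvPolynomial (Fin N) ℝ}
    (hP : P ∈ harmonicSubmodule N k) (x : EuclideanSpace ℝ (Fin N)) :
    Δ (fun x : EuclideanSpace ℝ (Fin N) => radialProfile N k (‖x‖ ^ 2) * polyFun P x) x =
      -(N * (N + 2) * ((1 + ‖x‖ ^ 2) ^ 2)⁻¹ * (radialProfile N k (‖x‖ ^ 2) * polyFun P x)) := by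
  obtain ⟨F₁, F₂, h1, h2, h3⟩ := radialProfile_ode N k (s := ‖x‖ ^ 2)
    (by nlinarith [sq_nonneg ‖x‖])
  rw [laplacian_comp_norm_sq_mul_polyFun hP (contDiffOn_radialProfile N k) x h1 h2,
    eq_neg_of_add_eq_zero_left h3]
  ring

theorem radialProfile_mul_polyFun_smul {k : ℕ} {P : MvPolynomial (Fin N) ℝ}
    (hP : P.IsHomogeneous k) (r : ℝ) (ξ : UnitSphere N) :
    radialProfile N k (‖r • (ξ : EuclideanSpace ℝ (Fin N))‖ ^ 2) *
      polyFun P (r • (ξ : EuclideanSpace ℝ (Fin N))) = radialPart N k r * polyFun P ξ := by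
  rw [norm_smul_sphere_sq, polyFun_smul hP, radialPart]
  ring

theorem hasDerivAt_comp_smul {f : EuclideanSpace ℝ (Fin N) → ℝ} (hf : Differentiable ℝ f)
    (y : EuclideanSpace ℝ (Fin N)) (r : ℝ) :
    HasDerivAt (fun t : ℝ => f (t • y)) (fderiv ℝ f (r • y) y) r := by
  have h := (hasDerivAt_id r).smul_const y
  rw [one_smul] at h
  exact (hf (r • y)).hasFDerivAt.comp_hasDerivAt r h

theorem hasDerivAt_integral_sphere_mul {v : EuclideanSpace ℝ (Fin N) → ℝ} (hv : ContDiff ℝ 1 v)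
    {q : UnitSphere N → ℝ} (hq : Continuous q) (r : ℝ) :
    HasDerivAt (fun t : ℝ => ∫ ξ : UnitSphere N, v (t • (ξ : EuclideanSpace ℝ (Fin N))) * q ξ
        ∂surfaceMeasure N)
      (∫ ξ : UnitSphere N, fderiv ℝ v (r • (ξ : EuclideanSpace ℝ (Fin N))) ξ * q ξ
        ∂surfaceMeasure N) r := by
  have hvc := hv.continuous
  have hc : Continuous fun z : ℝ × UnitSphere N =>
      fderiv ℝ v (z.1 • (z.2 : EuclideanSpace ℝ (Fin N))) z.2 * q z.2 :=
    (((hv.continuous_fderiv (by norm_num)).comp (by fun_prop)).clm_apply (by fun_prop)).mul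
      (by fun_prop)
  obtain ⟨B, hB⟩ := ((isCompact_closedBall r 1).prod
    (isCompact_univ (X := UnitSphere N))).exists_bound_of_continuousOn hc.continuousOn
  refine (hasDerivAt_integral_of_dominated_loc_of_deriv_le
    (F' := fun t (ξ : UnitSphere N) => fderiv ℝ v (t • (ξ : EuclideanSpace ℝ (Fin N))) ξ * q ξ)
    (bound := fun _ => B) (Metric.ball_mem_nhds r one_pos)
    (Filter.Eventually.of_forall fun t =>
      (by fun_prop : Continuous fun ξ : UnitSphere N =>
        v (t • (ξ : EuclideanSpace ℝ (Fin N))) * q ξ).aestronglyMeasurable)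
    (by fun_prop : Continuous fun ξ : UnitSphere N =>
        v (r • (ξ : EuclideanSpace ℝ (Fin N))) * q ξ).integrable_unitSphere
    (hc.comp (Continuous.prodMk_right r)).aestronglyMeasurable
    (Filter.Eventually.of_forall fun ξ t ht =>
      hB (t, ξ) ⟨Metric.ball_subset_closedBall ht, Set.mem_univ _⟩)
    (integrable_const B) (Filter.Eventually.of_forall fun ξ t _ => ?_)).2
  exact (hasDerivAt_comp_smul (hv.differentiable (by norm_num)) _ t).mul_const (q ξ)

/-- The coefficient of `v` along the harmonic polynomial `Q`, on the sphere of radius `r`. -/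
noncomputable def sphereCoeff (v : EuclideanSpace ℝ (Fin N) → ℝ) (Q : MvPolynomial (Fin N) ℝ)
    (r : ℝ) : ℝ :=
  ∫ ξ : UnitSphere N, v (r • (ξ : EuclideanSpace ℝ (Fin N))) * polyFun Q ξ ∂surfaceMeasure N

theorem hasDerivAt_sphereCoeff {v : EuclideanSpace ℝ (Fin N) → ℝ} (hv : ContDiff ℝ 1 v)
    (Q : MvPolynomial (Fin N) ℝ) (r : ℝ) : HasDerivAt (sphereCoeff v Q)
      (∫ ξ : UnitSphere N, fderiv ℝ v (r • (ξ : EuclideanSpace ℝ (Fin N))) ξ * polyFun Q ξ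
        ∂surfaceMeasure N) r :=
  hasDerivAt_integral_sphere_mul hv ((continuous_polyFun Q).comp continuous_subtype_val) r

theorem sphereCoeff_mul_deriv_radialPart (hN : 3 ≤ N) {v : EuclideanSpace ℝ (Fin N) → ℝ}
    (hv : IsLinearizedSolution N v) {k : ℕ} {Q : MvPolynomial (Fin N) ℝ}
    (hQ : Q ∈ harmonicSubmodule N k) {r : ℝ} (hr : 0 < r) :
    sphereCoeff v Q r * deriv (radialPart N k) r =
      radialPart N k r * deriv (sphereCoeff v Q) r := by
  set u : EuclideanSpace ℝ (Fin N) → ℝ := fun x => radialProfile N k (‖x‖ ^ 2) * polyFun Q x with hu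
  have hu2 : ContDiff ℝ 2 u :=
    (contDiff_comp_norm_sq_mul_polyFun (contDiffOn_radialProfile N k) Q).of_le (by norm_cast)
  have hur : ∀ (t : ℝ) (ξ : UnitSphere N), u (t • (ξ : EuclideanSpace ℝ (Fin N))) =
    radialPart N k t * polyFun Q ξ := fun t ξ => radialProfile_mul_polyFun_smul hQ.1 t ξ
  have hdu : ∀ ξ : UnitSphere N, fderiv ℝ u (r • (ξ : EuclideanSpace ℝ (Fin N))) ξ =
      deriv (radialPart N k) r * polyFun Q ξ := fun ξ => by
    refine (hasDerivAt_comp_smul (hu2.differentiable (by norm_num)) _ r).unique ?_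
    simp only [hur]
    exact (differentiable_radialPart N k r).hasDerivAt.mul_const _
  have hW := integral_sphere_wronskian_eq_zero (by omega : 0 < N) hu2 hv.1 (fun x => by
    have h1 := hv.2 x
    rw [bubble_rpow_critExp_sub_one hN] at h1
    rw [laplacian_radialProfile_mul_polyFun hQ x, ← neg_neg (Δ v x), h1]
    ring) hr
  have hv1 : ContDiff ℝ 1 v := hv.1.of_le (by norm_num)
  have hvc := hv1.continuous
  have hdc : Continuous fun ξ : UnitSphere N => fderiv ℝ v (r • (ξ : EuclideanSpace ℝ (Fin N))) ξ :=
    ((hv1.continuous_fderiv (by norm_num)).comp (by fun_prop)).clm_apply (by fun_prop)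
  have hQc : Continuous fun ξ : UnitSphere N => polyFun Q ξ :=
    (continuous_polyFun Q).comp continuous_subtype_val
  have e : ∀ ξ : UnitSphere N, v (r • (ξ : EuclideanSpace ℝ (Fin N))) *
      fderiv ℝ u (r • (ξ : EuclideanSpace ℝ (Fin N))) ξ - u (r • (ξ : EuclideanSpace ℝ (Fin N))) *
        fderiv ℝ v (r • (ξ : EuclideanSpace ℝ (Fin N))) ξ =
      deriv (radialPart N k) r * (v (r • (ξ : EuclideanSpace ℝ (Fin N))) * polyFun Q ξ) -
      radialPart N k r * (fderiv ℝ v (r • (ξ : EuclideanSpace ℝ (Fin N))) ξ * polyFun Q ξ) :=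
    fun ξ => by rw [hdu, hur]; ring
  simp only [e] at hW
  rw [integral_sub (by fun_prop : Continuous _).integrable_unitSphere
    (by fun_prop : Continuous _).integrable_unitSphere, integral_const_mul, integral_const_mul] at hW
  rw [(hasDerivAt_sphereCoeff hv1 Q r).deriv, mul_comm]
  exact sub_eq_zero.mp hW

end RadialPart

/-! ### Vanishing Wronskian implies proportionality. -/

section Wronskian

theorem mul_eq_mul_of_wronskian_eq_zero {A f : ℝ → ℝ} (hA : Differentiable ℝ A)
    (hf : Differentiable ℝ f) {s : Set ℝ} (hs : IsOpen s) (hs' : IsPreconnected s)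
    (hW : ∀ r ∈ s, A r * deriv f r = f r * deriv A r) (hf0 : ∀ r ∈ s, f r ≠ 0) {a b : ℝ}
    (ha : a ∈ s) (hb : b ∈ s) : A a * f b = A b * f a := by
  have h : A a / f a = A b / f b := by
    refine hs.is_const_of_deriv_eq_zero (f := fun r => A r / f r) hs'
      (fun r hr => ((hA r).div (hf r) (hf0 r hr)).differentiableWithinAt) (fun r hr => ?_) ha hb
    have := ((hA r).hasDerivAt.div (hf r).hasDerivAt (hf0 r hr)).deriv
    refine this.trans ?_
    rw [hW r hr]
    simp [mul_comm]
  rwa [div_eq_div_iff (hf0 a ha) (hf0 b hb)] at h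

/-- Needed for `k = 0`, whose radial solution changes sign at `r = 1`: the quotient argument works
on each side of the zero, and the two constants must be matched. The difference `D` vanishes left of
`z`, so `D(z) = D'(z) = 0`. To the right `D` is proportional to `f`, and differentiating that
relation at the simple zero gives `D = 0`. -/
theorem mul_eq_mul_of_wronskian_eq_zero_of_simple_zero {A f : ℝ → ℝ} (hA : Differentiable ℝ A)
    (hf : Differentiable ℝ f) (hW : ∀ r, 0 < r → A r * deriv f r = f r * deriv A r)
    {z : ℝ} (hz : f z = 0) (hz' : deriv f z ≠ 0) (hf0 : ∀ r, 0 < r → r ≠ z → f r ≠ 0)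
    {a r : ℝ} (ha : 0 < a) (haz : a < z) (hr : 0 < r) : A r * f a = A a * f r := by
  set D : ℝ → ℝ := fun r => A r * f a - A a * f r with hD
  have hDd : Differentiable ℝ D := (hA.mul_const _).sub (hf.const_mul _)
  have hDW : ∀ r, 0 < r → D r * deriv f r = f r * deriv D r := fun r hr => by
    have : deriv D r = deriv A r * f a - A a * deriv f r :=
      (((hA r).hasDerivAt.mul_const _).sub ((hf r).hasDerivAt.const_mul _)).deriv
    rw [this]
    simp only [hD]
    linear_combination f a * hW r hr
  have hleft : ∀ t ∈ Set.Ioo 0 z, D t = 0 := fun t ht => sub_eq_zero.mpr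
    (mul_eq_mul_of_wronskian_eq_zero hA hf isOpen_Ioo isPreconnected_Ioo (fun r hr => hW r hr.1)
      (fun r hr => hf0 r hr.1 hr.2.ne) ht ⟨ha, haz⟩)
  have hz0 : 0 < z := ha.trans haz
  have hDz : D z = 0 := by
    have := hDW z hz0
    rw [hz, zero_mul] at this
    exact (mul_eq_zero.mp this).resolve_right hz'
  have hD' : deriv D z = 0 := by
    have h1 : HasDerivWithinAt D 0 (Set.Iio z) z := by
      refine (hasDerivWithinAt_const z _ (0 : ℝ)).congr_of_eventuallyEq ?_ hDz
      filter_upwards [Ioo_mem_nhdsLT hz0] with t ht using hleft t ht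
    exact (uniqueDiffWithinAt_Iio z).eq_deriv _ (hDd z).hasDerivAt.hasDerivWithinAt h1
  have hright : ∀ t ∈ Set.Ioi z, ∀ b ∈ Set.Ioi z, D t * f b = D b * f t := fun t ht b hb =>
    mul_eq_mul_of_wronskian_eq_zero hDd hf isOpen_Ioi isPreconnected_Ioi
      (fun r hr => hDW r (hz0.trans hr)) (fun r hr => hf0 r (hz0.trans hr) (ne_of_gt hr)) ht hb
  have key : D r = 0 := by
    rcases lt_trichotomy r z with h | h | h
    · exact hleft r ⟨hr, h⟩
    · rw [h, hDz]
    · have h1 : HasDerivWithinAt (fun t => D t * f r) (deriv D z * f r) (Set.Ioi z) z :=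
        ((hDd z).hasDerivAt.mul_const _).hasDerivWithinAt
      have h2 : HasDerivWithinAt (fun t => D t * f r) (D r * deriv f z) (Set.Ioi z) z :=
        ((hf z).hasDerivAt.const_mul (D r)).hasDerivWithinAt.congr (fun t ht => hright t ht r h)
          (by rw [hDz, hz, zero_mul, mul_zero])
      have h3 := (uniqueDiffWithinAt_Ioi z).eq_deriv _ h1 h2
      rw [hD', zero_mul] at h3
      exact (mul_eq_zero.mp h3.symm).resolve_right hz'
  exact sub_eq_zero.mp key

end Wronskian

/-! ### Each coefficient is a multiple of the regular mode. -/

section Modes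

variable {N : ℕ}

theorem radialPart_pos (N : ℕ) {k : ℕ} (hk : 1 ≤ k) {r : ℝ} (hr : 0 < r) :
    0 < radialPart N k r := by
  refine mul_pos (pow_pos hr k) ?_
  rcases hk.eq_or_lt with rfl | hk
  · rw [radialProfile_one]
    positivity
  · obtain ⟨c, C, hc, -, h⟩ := radialProfile_bounds N hk
    exact hc.trans_le (h _ (sq_nonneg r)).1

theorem radialPart_zero (N : ℕ) (r : ℝ) :
    radialPart N 0 r = (1 + r ^ 2) ^ (-((N : ℝ) / 2)) * (1 - r ^ 2) := by
  rw [radialPart, pow_zero, one_mul, radialProfile_zero]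

/-- The radius `1/2` serves for normalisation in every degree; it avoids the zero at `r = 1` of the
degree `0` mode. -/
theorem radialPart_half_ne_zero (N k : ℕ) : radialPart N k (1 / 2) ≠ 0 := by
  rcases Nat.eq_zero_or_pos k with rfl | hk
  · rw [radialPart_zero]
    have : (0 : ℝ) < 1 + (1 / 2) ^ 2 := by norm_num
    exact mul_ne_zero (Real.rpow_pos_of_pos this _).ne' (by norm_num)
  · exact (radialPart_pos N hk (by norm_num)).ne'

theorem deriv_radialPart_zero_one_ne_zero (N : ℕ) : deriv (radialPart N 0) 1 ≠ 0 := by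
  have h1 : HasDerivAt (fun r : ℝ => 1 - r ^ 2) (-2) 1 := by
    simpa using (hasDerivAt_pow 2 (1 : ℝ)).const_sub 1
  have h2 : DifferentiableAt ℝ (fun r : ℝ => (1 + r ^ 2) ^ (-((N : ℝ) / 2))) 1 :=
    DifferentiableAt.rpow_const (by fun_prop) (Or.inl (by norm_num))
  have h3 := (h2.hasDerivAt.mul h1).deriv
  simp only [Pi.mul_def] at h3
  rw [funext (radialPart_zero N), h3]
  have : (0 : ℝ) < (1 + 1 ^ 2) ^ (-((N : ℝ) / 2)) := Real.rpow_pos_of_pos (by norm_num) _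
  simp only [one_pow, sub_self, mul_zero, zero_add] at this ⊢
  exact mul_ne_zero this.ne' (by norm_num)

/-- The coefficients of a solution are multiples of the regular radial solution. -/
theorem sphereCoeff_mul_radialPart_half (hN : 3 ≤ N) {v : EuclideanSpace ℝ (Fin N) → ℝ}
    (hv : IsLinearizedSolution N v) {k : ℕ} {Q : MvPolynomial (Fin N) ℝ}
    (hQ : Q ∈ harmonicSubmodule N k) {r : ℝ} (hr : 0 < r) :
    sphereCoeff v Q r * radialPart N k (1 / 2) = sphereCoeff v Q (1 / 2) * radialPart N k r := by
  have hA : Differentiable ℝ (sphereCoeff v Q) := fun t =>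
    (hasDerivAt_sphereCoeff (hv.1.of_le (by norm_num)) Q t).differentiableAt
  have hW := fun t (ht : 0 < t) => sphereCoeff_mul_deriv_radialPart hN hv hQ ht
  rcases Nat.eq_zero_or_pos k with rfl | hk
  · refine mul_eq_mul_of_wronskian_eq_zero_of_simple_zero hA (differentiable_radialPart N 0) hW
      (z := 1) (by simp [radialPart_zero]) (deriv_radialPart_zero_one_ne_zero N)
      (fun t ht ht1 => ?_) (by norm_num) (by norm_num) hr
    rw [radialPart_zero]
    have : (0 : ℝ) < 1 + t ^ 2 := by positivity
    refine mul_ne_zero (Real.rpow_pos_of_pos this _).ne' fun h => ht1 ?_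
    nlinarith
  · exact mul_eq_mul_of_wronskian_eq_zero hA (differentiable_radialPart N k) isOpen_Ioi
      isPreconnected_Ioi hW (fun t ht => (radialPart_pos N hk ht).ne') hr
      (by norm_num : (0 : ℝ) < 1 / 2)

/-- The radial traces of a continuous function, as continuous functions on the sphere. -/
def sphereTrace {v : EuclideanSpace ℝ (Fin N) → ℝ} (hv : Continuous v) (r : ℝ) :
    C(UnitSphere N, ℝ) :=
  ⟨fun ξ => v (r • (ξ : EuclideanSpace ℝ (Fin N))), by fun_prop⟩

theorem spherePairing_sphereTrace {v : EuclideanSpace ℝ (Fin N) → ℝ} (hv : Continuous v) (r : ℝ)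
    (Q : MvPolynomial (Fin N) ℝ) : spherePairing (sphereTrace hv r) Q = sphereCoeff v Q r :=
  spherePairing_apply _ _

theorem spherePairing_add (f g : C(UnitSphere N, ℝ)) (Q : MvPolynomial (Fin N) ℝ) :
    spherePairing (f + g) Q = spherePairing f Q + spherePairing g Q := by
  simp only [spherePairing, LinearMap.coe_mk, AddHom.coe_mk, ContinuousMap.add_apply, add_mul]
  exact integral_add (by fun_prop : Continuous _).integrable_unitSphere
    (by fun_prop : Continuous _).integrable_unitSphere

theorem spherePairing_smul (a : ℝ) (g : C(UnitSphere N, ℝ)) (Q : MvPolynomial (Fin N) ℝ) :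
    spherePairing (a • g) Q = a * spherePairing g Q := by
  simp only [spherePairing, LinearMap.coe_mk, AddHom.coe_mk, ContinuousMap.smul_apply, smul_eq_mul,
    mul_assoc, integral_const_mul]

theorem spherePairing_sum {ι : Type*} (s : Finset ι) (g : ι → C(UnitSphere N, ℝ))
    (Q : MvPolynomial (Fin N) ℝ) :
    spherePairing (∑ i ∈ s, g i) Q = ∑ i ∈ s, spherePairing (g i) Q :=
  map_sum (AddMonoidHom.mk' (fun g => spherePairing g Q) fun f g => spherePairing_add f g Q) g s

theorem exists_sphereCoeff_eq (hN : 3 ≤ N) {v : EuclideanSpace ℝ (Fin N) → ℝ}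
    (hv : IsLinearizedSolution N v) (k : ℕ) : ∃ Y ∈ harmonicSubmodule N k,
      ∀ Q ∈ harmonicSubmodule N k, ∀ r, 0 < r →
        sphereCoeff v Q r = radialPart N k r * spherePairing (sphereRestrict N Y) Q := by
  obtain ⟨Y, hY, h⟩ := exists_harmonic_projection
    ((radialPart N k (1 / 2))⁻¹ • sphereTrace hv.1.continuous (1 / 2)) k
  refine ⟨Y, hY, fun Q hQ r hr => ?_⟩
  have h0 := radialPart_half_ne_zero N k
  rw [← h Q hQ, spherePairing_smul, spherePairing_sphereTrace]
  have := sphereCoeff_mul_radialPart_half hN hv hQ hr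
  field_simp
  linarith

end Modes

/-! ### Elimination of high degrees by growth. -/

section Growth

variable {N : ℕ}

theorem abs_sphereCoeff_le {v : EuclideanSpace ℝ (Fin N) → ℝ} {τ C : ℝ}
    (hC : ∀ x, 1 ≤ ‖x‖ → |v x| ≤ C * ‖x‖ ^ τ) (Q : MvPolynomial (Fin N) ℝ) :
    ∃ B : ℝ, ∀ r, 1 ≤ r → |sphereCoeff v Q r| ≤ B * r ^ τ := by
  have hQc : Continuous fun ξ : UnitSphere N => polyFun Q ξ :=
    (continuous_polyFun Q).comp continuous_subtype_val
  obtain ⟨M, hM⟩ := (isCompact_univ (X := UnitSphere N)).exists_bound_of_continuousOn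
    hQc.continuousOn
  refine ⟨C * M * (surfaceMeasure N).real Set.univ, fun r hr => ?_⟩
  have hr0 : 0 ≤ r := by linarith
  have h := norm_integral_le_of_norm_le_const (μ := surfaceMeasure N) (C := C * r ^ τ * M)
    (f := fun ξ : UnitSphere N => v (r • (ξ : EuclideanSpace ℝ (Fin N))) * polyFun Q ξ)
    (Filter.Eventually.of_forall fun ξ => by
      have hn : ‖r • (ξ : EuclideanSpace ℝ (Fin N))‖ = r := by simp [norm_smul, abs_of_nonneg hr0]
      have h1 := hC (r • (ξ : EuclideanSpace ℝ (Fin N))) (by rw [hn]; exact hr)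
      rw [hn] at h1
      rw [norm_mul]
      exact mul_le_mul h1 (hM ξ (Set.mem_univ _)) (norm_nonneg _) ((abs_nonneg _).trans h1))
  refine h.trans_eq ?_
  ring

/-- The coefficient is `O(r^τ)`, whereas a nonzero multiple of the mode is at least of order `r^k`.
-/
theorem spherePairing_eq_zero_of_growth {v : EuclideanSpace ℝ (Fin N) → ℝ} {τ C : ℝ}
    (hC : ∀ x, 1 ≤ ‖x‖ → |v x| ≤ C * ‖x‖ ^ τ) {k : ℕ} (hk : 2 ≤ k) (hkτ : τ < k)
    {Q : MvPolynomial (Fin N) ℝ} {m : ℝ}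
    (hm : ∀ r, 0 < r → sphereCoeff v Q r = radialPart N k r * m) : m = 0 := by
  obtain ⟨B, hB⟩ := abs_sphereCoeff_le hC Q
  obtain ⟨c, _, hc, _, hcb⟩ := radialProfile_bounds N hk
  by_contra hne
  have hm0 : 0 < c * |m| := mul_pos hc (abs_pos.mpr hne)
  have ht := (tendsto_rpow_atTop (sub_pos.mpr hkτ)).eventually_gt_atTop (B / (c * |m|))
  obtain ⟨r, hr, hr1⟩ := (ht.and (Filter.eventually_ge_atTop 1)).exists
  have hr0 : 0 < r := by linarith
  have h1 := hB r hr1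
  rw [hm r hr0, abs_mul, radialPart, abs_mul, abs_of_pos (pow_pos hr0 k)] at h1
  rw [div_lt_iff₀ hm0, Real.rpow_sub hr0, Real.rpow_natCast] at hr
  have hτ0 : 0 < r ^ τ := Real.rpow_pos_of_pos hr0 τ
  have h2 : B * r ^ τ < r ^ k * (c * |m|) := by
    have := mul_lt_mul_of_pos_right hr hτ0
    field_simp at this
    linarith
  have h3 : r ^ k * (c * |m|) ≤ r ^ k * |radialProfile N k (r ^ 2)| * |m| := by
    rw [← mul_assoc]
    have := (hcb (r ^ 2) (sq_nonneg r)).1.trans (le_abs_self _)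
    gcongr
  linarith

theorem comparableAlong_radialPart (N : ℕ) {k : ℕ} (hk : 2 ≤ k) {l : Filter ℝ}
    (hl : ∀ᶠ r in l, 0 < r) : ComparableAlong l (radialPart N k) fun r => r ^ k := by
  obtain ⟨c, C, hc, hC, h⟩ := radialProfile_bounds N hk
  refine ⟨C + c⁻¹, by positivity, ?_⟩
  filter_upwards [hl] with r hr
  obtain ⟨h1, h2⟩ := h (r ^ 2) (sq_nonneg r)
  have hrk : 0 < r ^ k := pow_pos hr k
  have hci : 0 < c⁻¹ := inv_pos.mpr hc
  refine ⟨(radialPart_pos N (by omega) hr).le, hrk.le, ?_, ?_⟩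
  · rw [radialPart, mul_comm]
    gcongr
    linarith
  · calc r ^ k = c⁻¹ * (r ^ k * c) := by field_simp
      _ ≤ c⁻¹ * radialPart N k r := by rw [radialPart]; gcongr
      _ ≤ (C + c⁻¹) * radialPart N k r := by
        have := (radialPart_pos N (by omega : 1 ≤ k) hr).le
        gcongr
        linarith

end Growth

/-! ### Degrees `0` and `1` are the explicit kernel functions. -/

section LowDegree

variable {N : ℕ}

theorem polyFun_of_isHomogeneous_zero {P : MvPolynomial (Fin N) ℝ} (hP : P.IsHomogeneous 0)
    (x : EuclideanSpace ℝ (Fin N)) : polyFun P x = MvPolynomial.coeff 0 P := by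
  conv_lhs => rw [MvPolynomial.totalDegree_eq_zero_iff_eq_C.mp
    ((MvPolynomial.totalDegree_zero_iff_isHomogeneous _).mpr hP)]
  simp [polyFun]

theorem polyFun_of_isHomogeneous_one {P : MvPolynomial (Fin N) ℝ} (hP : P.IsHomogeneous 1)
    (x : EuclideanSpace ℝ (Fin N)) :
    polyFun P x = ∑ i, x i * MvPolynomial.coeff 0 (MvPolynomial.pderiv i P) := by
  have h := sum_mul_polyFun_pderiv hP x
  rw [Nat.cast_one, one_mul] at h
  rw [← h]
  exact Finset.sum_congr rfl fun i _ => by rw [polyFun_of_isHomogeneous_zero hP.pderiv]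

theorem kernelZero_smul (r : ℝ) (ξ : UnitSphere N) :
    kernelZero N (r • (ξ : EuclideanSpace ℝ (Fin N))) = radialPart N 0 r := by
  rw [kernelZero, norm_smul_sphere_sq, radialPart_zero, Real.rpow_neg (by positivity)]
  ring

theorem kernelTrans_smul (i : Fin N) (r : ℝ) (ξ : UnitSphere N) :
    kernelTrans N i (r • (ξ : EuclideanSpace ℝ (Fin N))) =
      radialPart N 1 r * (ξ : EuclideanSpace ℝ (Fin N)) i := by
  rw [kernelTrans, norm_smul_sphere_sq, radialPart, radialProfile_one,
    Real.rpow_neg (by positivity), PiLp.smul_apply, smul_eq_mul]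
  ring

end LowDegree

/-- A solution of polynomial growth is a finite sum of separated modes. -/
theorem eq_sum_radialPart_mul_polyFun {N : ℕ} (hN : 3 ≤ N) {v : EuclideanSpace ℝ (Fin N) → ℝ}
    (hv : IsLinearizedSolution N v) {Y : ℕ → MvPolynomial (Fin N) ℝ}
    (hY : ∀ k, Y k ∈ harmonicSubmodule N k)
    (hcoeff : ∀ k, ∀ Q ∈ harmonicSubmodule N k, ∀ r, 0 < r →
      sphereCoeff v Q r = radialPart N k r * spherePairing (sphereRestrict N (Y k)) Q)
    (s : Finset ℕ)
    (hs : ∀ k, k ∉ s → ∀ Q ∈ harmonicSubmodule N k,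
      spherePairing (sphereRestrict N (Y k)) Q = 0)
    {r : ℝ} (hr : 0 < r) (ξ : UnitSphere N) :
    v (r • (ξ : EuclideanSpace ℝ (Fin N))) = ∑ k ∈ s, radialPart N k r * polyFun (Y k) ξ := by
  have hN0 : 0 < N := by omega
  have horth : ∀ k l, k ≠ l → ∀ Q ∈ harmonicSubmodule N l,
      spherePairing (sphereRestrict N (Y k)) Q = 0 := fun k l hkl Q hQ => by
    rw [spherePairing_apply]
    simp only [sphereRestrict_apply]
    exact integral_sphere_mul_eq_zero_of_ne hN0 hkl (hY k) hQ
  have h : sphereTrace hv.1.continuous r +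
      (-1 : ℝ) • ∑ k ∈ s, radialPart N k r • sphereRestrict N (Y k) = 0 := by
    refine eq_zero_of_orthogonal_harmonics hN0 fun l Q hQ => ?_
    rw [spherePairing_add, spherePairing_smul, spherePairing_sum, spherePairing_sphereTrace,
      hcoeff l Q hQ r hr]
    simp only [spherePairing_smul]
    by_cases hl : l ∈ s
    · rw [Finset.sum_eq_single_of_mem l hl fun k _ hkl => by rw [horth k l hkl Q hQ, mul_zero]]
      ring
    · rw [hs l hl Q hQ, Finset.sum_eq_zero fun k hk => by
        rw [horth k l (fun e => hl (e ▸ hk)) Q hQ, mul_zero]]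
      ring
  have h' := congrArg (fun g : C(UnitSphere N, ℝ) => g ξ) h
  simp only [ContinuousMap.add_apply, ContinuousMap.smul_apply, ContinuousMap.sum_apply,
    sphereRestrict_apply, smul_eq_mul, ContinuousMap.zero_apply, neg_mul, one_mul] at h'
  exact eq_of_sub_eq_zero ((sub_eq_add_neg _ _).trans h')

theorem mainTheorem3 (N : ℕ) (hN : 3 ≤ N) (τ : ℝ) (hτ : -(N : ℝ) + 2 ≤ τ)
    (v : EuclideanSpace ℝ (Fin N) → ℝ) (hv : IsLinearizedSolution N v)
    (hgrowth : ∃ C : ℝ, ∀ x, 1 ≤ ‖x‖ → |v x| ≤ C * ‖x‖ ^ τ) :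
    ∃ (c₀ : ℝ) (c : Fin N → ℝ) (vm : ℕ → ℝ → ℝ)
      (Y : ℕ → Metric.sphere (0 : EuclideanSpace ℝ (Fin N)) 1 → ℝ),
      (∀ k, 2 ≤ k → ContDiffOn ℝ ∞ (vm k) (Set.Ioi 0)) ∧
      (∀ k, 2 ≤ k → IsSphericalHarmonic N k (Y k)) ∧
      (∀ (r : ℝ) (ξ : Metric.sphere (0 : EuclideanSpace ℝ (Fin N)) 1), 0 < r →
        v (r • (ξ : EuclideanSpace ℝ (Fin N))) =
          c₀ * kernelZero N (r • (ξ : EuclideanSpace ℝ (Fin N))) +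
          ∑ i, c i * kernelTrans N i (r • (ξ : EuclideanSpace ℝ (Fin N))) +
          ∑ k ∈ Finset.Icc 2 ⌊τ⌋₊, vm k r * Y k ξ) ∧
      (∀ k, 2 ≤ k →
        (∀ r, 0 < r → vm k r = 0) ∨
        (ComparableAlong (𝓝[>] 0) (vm k) (fun r => r ^ k) ∧
          ComparableAlong Filter.atTop (vm k) (fun r => r ^ k))) := by

  obtain ⟨C, hC⟩ := hgrowth
  choose Y hY hcoeff using exists_sphereCoeff_eq hN hv
  -- The radial functions are the modes themselves, which never vanish on the half-line for `k ≥ 2`;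
  -- an absent degree is encoded by a zero harmonic, so the second alternative always holds.
  refine ⟨MvPolynomial.coeff 0 (Y 0),
    fun i => MvPolynomial.coeff 0 (MvPolynomial.pderiv i (Y 1)), radialPart N,
    fun k ξ => polyFun (Y k) ξ, fun k _ => (contDiff_radialPart N k).contDiffOn,
    fun k _ => ⟨Y k, (MvPolynomial.mem_harmonicSubmodule.mp (hY k)).1,
      (MvPolynomial.mem_harmonicSubmodule.mp (hY k)).2, fun _ => rfl⟩, fun r ξ hr => ?_,
    fun k hk => Or.inr ⟨comparableAlong_radialPart N hk self_mem_nhdsWithin,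
      comparableAlong_radialPart N hk (Filter.eventually_gt_atTop 0)⟩⟩
  -- Degrees `0` and `1` are kept whatever `τ` is. For negative `τ` the natural floor is `0`, so the
  -- interval is empty as required.
  rw [eq_sum_radialPart_mul_polyFun hN hv hY hcoeff (insert 0 (insert 1 (Finset.Icc 2 ⌊τ⌋₊)))
    (fun k hk Q hQ => ?_) hr ξ, Finset.sum_insert (by simp), Finset.sum_insert (by simp),
    polyFun_of_isHomogeneous_zero (hY 0).1, polyFun_of_isHomogeneous_one (hY 1).1, kernelZero_smul]
  · simp only [kernelTrans_smul, Finset.mul_sum, ← add_assoc]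
    congr 2
    · ring
    · exact Finset.sum_congr rfl fun i _ => by ring
  · simp only [Finset.mem_insert, Finset.mem_Icc, not_or, not_and, not_le] at hk
    have hk2 : 2 ≤ k := by omega
    exact spherePairing_eq_zero_of_growth hC hk2 (Nat.lt_of_floor_lt (hk.2.2 hk2))
      (hcoeff k Q hQ)
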